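/- Let $k$ be a field of characteristic zero. Let $\mathrm{Ass}_n$ be the degree completion of the free associative $k$-algebra on $x_1,\dots,x_n$ (for $n=2,3$ we write $x,y,z$), and let $\mathfrak{lie}_n\subset \mathrm{Ass}_n$ be the degree completion of the free Lie algebra on the same generators. Define $\partial_i$ on $\mathrm{Ass}_n$ by $a=a_0+\sum_i(\partial_i a)x_i$ with $a_0\in k$. Let $\mathfrak{tr}_n$ be the quotient of the space of series without constant term in $\mathrm{Ass}_n$ by the span of all commutators $ab-ba$, $a,b\in\mathrm{Ass}_n$, and let $\mathrm{Tr}:\mathrm{Ass}_n\to\mathfrak{tr}_n$ be the projection (zero on constants). Let $\mathrm{ch}(x,y)=\ln(e^xe^y)\in\mathrm{Ass}_2$. Define $\delta:\mathfrak{tr}_2\to\mathfrak{tr}_3$ and $\tilde\delta:\mathfrak{tr}_1\to\mathfrak{tr}_2$ by $$(\delta f)(x,y,z)=f(y,z)-f(x+y,z)+f(x,y+z)-f(x,y),\qquad (\tilde\delta f)(x,y)=f(y)-f(\mathrm{ch}(x,y))+f(x).$$ A tangential derivation of $\mathfrak{lie}_2$ is a derivation $u$ with $u(x)=[x,a]$,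 $u(y)=[y,b]$ for some $a,b\in\mathfrak{lie}_2$; $a$ and $b$ are unique once normalized so that $a$ has no term in $x$ and $b$ has no term in $y$. Such a $u$ acts on $\mathrm{Ass}_2$ and $\mathfrak{tr}_2$. Its divergence is $\mathrm{div}(u)=\mathrm{Tr}(x\,\partial_x a+y\,\partial_y b)\in\mathfrak{tr}_2$ (with $a,b$ normalized). Let $\exp(u)=\sum_{r\ge 0}u^r/r!$, let $\mathrm{TAut}_2$ be the group, under composition, of the automorphisms $\exp(u)$ with $u$ a tangential derivation, and set $$j(\exp(u))=\frac{e^u-1}{u}\cdot\mathrm{div}(u)=\sum_{r\ge0}\frac{1}{(r+1)!}\,u^r\cdot\mathrm{div}(u)\in\mathfrak{tr}_2 .$$ Let $$\mathfrak{hkv}_2=\{u \text{ a tangential derivation of } \mathfrak{lie}_2:\ u(x+y)=0,\ \mathrm{div}(u)\in\ker\delta\},\qquad \mathrm{HKV}_2=\exp(\mathfrak{hkv}_2),$$ $$\mathrm{Sol}(\mathrm{HKV})=\{F\in\mathrm{TAut}_2:\ F(x+y)=\mathrm{ch}(x,y),\ j(F)\in\mathrm{im}\,\tilde\delta\}.$$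 **Theorem.** Assume that $\mathrm{Sol}(\mathrm{HKV})$ is nonempty. Then $\mathrm{HKV}_2$ is a group under composition, and it acts on $\mathrm{Sol}(\mathrm{HKV})$ by multiplication on the right, $F\mapsto Fg$. This action is free and transitive. -/

import Mathlib

noncomputable section

namespace KashiwaraVergne

/-- `Ass k n` is the degree completion of the free associative algebra over `k` on `n` generators:
formal (infinite) linear combinations of words in the letters `Fin n`, a series being given by
its coefficients. -/
@[ext] structure Ass (k : Type*) (n : ℕ) where
  /-- The coefficient of a word. -/
  coeff : List (Fin n) → k

instance {k : Type*} {n : ℕ} : CoeFun (Ass k n) fun _ => List (Fin n) → k := ⟨Ass.coeff⟩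

section Algebra

variable {k : Type*} [Field k] {m n : ℕ}

instance : Zero (Ass k n) := ⟨⟨fun _ => 0⟩⟩
instance : Add (Ass k n) := ⟨fun f g => ⟨fun w => f w + g w⟩⟩
instance : Neg (Ass k n) := ⟨fun f => ⟨fun w => -f w⟩⟩
instance : Sub (Ass k n) := ⟨fun f g => ⟨fun w => f w - g w⟩⟩
instance : SMul k (Ass k n) := ⟨fun c f => ⟨fun w => c * f w⟩⟩
instance : SMul ℕ (Ass k n) := ⟨fun c f => ⟨fun w => c • f w⟩⟩
instance : SMul ℤ (Ass k n) := ⟨fun c f => ⟨fun w => c • f w⟩⟩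

theorem Ass.coeff_injective {k : Type*} {n : ℕ} :
    Function.Injective (Ass.coeff : Ass k n → List (Fin n) → k) := fun _ _ h => Ass.ext h

instance : AddCommGroup (Ass k n) :=
  Ass.coeff_injective.addCommGroup _ rfl (fun _ _ => rfl) (fun _ => rfl) (fun _ _ => rfl)
    (fun _ _ => rfl) (fun _ _ => rfl)

/-- The coefficients, as an additive homomorphism. -/
def Ass.coeffHom : Ass k n →+ (List (Fin n) → k) where
  toFun := Ass.coeff
  map_zero' := rfl
  map_add' _ _ := rfl

instance : Module k (Ass k n) :=
  Ass.coeff_injective.module k Ass.coeffHom (fun _ _ => rfl)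

@[simp] theorem Ass.add_apply (f g : Ass k n) (w : List (Fin n)) : (f + g) w = f w + g w := rfl
@[simp] theorem Ass.sub_apply (f g : Ass k n) (w : List (Fin n)) : (f - g) w = f w - g w := rfl
@[simp] theorem Ass.zero_apply (w : List (Fin n)) : (0 : Ass k n) w = 0 := rfl
@[simp] theorem Ass.neg_apply (f : Ass k n) (w : List (Fin n)) : (-f) w = -f w := rfl
@[simp] theorem Ass.smul_apply (c : k) (f : Ass k n) (w : List (Fin n)) :
    (c • f) w = c * f w := rfl

theorem Ass.sum_apply {ι : Type*} (s : Finset ι) (g : ι → Ass k n) (w : List (Fin n)) :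
    (∑ i ∈ s, g i) w = ∑ i ∈ s, g i w := by
  have := congrFun (map_sum Ass.coeffHom g s) w
  rwa [Finset.sum_apply] at this

/-- The unit series. -/
instance : One (Ass k n) := ⟨⟨fun w => if w = [] then 1 else 0⟩⟩

/-- Concatenation product: the coefficient of `w` in `f * g` is the sum of `f u * g v` over all
factorizations `w = u v`. -/
instance : Mul (Ass k n) :=
  ⟨fun f g => ⟨fun w => ∑ i ∈ Finset.range (w.length + 1), f (w.take i) * g (w.drop i)⟩⟩

theorem Ass.one_apply (w : List (Fin n)) : (1 : Ass k n) w = if w = [] then 1 else 0 := rfl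

theorem Ass.mul_apply (f g : Ass k n) (w : List (Fin n)) :
    (f * g) w = ∑ i ∈ Finset.range (w.length + 1), f (w.take i) * g (w.drop i) := rfl

/-- Removal of a given first letter. -/
def Ass.lshift (a : Fin n) (f : Ass k n) : Ass k n := ⟨fun w => f (a :: w)⟩

@[simp] theorem Ass.mul_nil (f g : Ass k n) : (f * g) [] = f [] * g [] := by
  simp [Ass.mul_apply]

theorem Ass.mul_cons (f g : Ass k n) (a : Fin n) (w : List (Fin n)) :
    (f * g) (a :: w) = f [] * g (a :: w) + (Ass.lshift a f * g) w := by
  simp only [Ass.mul_apply, List.length_cons]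
  rw [Finset.sum_range_succ', add_comm]
  simp [Ass.lshift]

theorem Ass.add_mul' (f g h : Ass k n) : (f + g) * h = f * h + g * h := by
  ext w; simp [Ass.mul_apply, add_mul, Finset.sum_add_distrib]

theorem Ass.mul_add' (f g h : Ass k n) : f * (g + h) = f * g + f * h := by
  ext w; simp [Ass.mul_apply, mul_add, Finset.sum_add_distrib]

theorem Ass.smul_mul' (c : k) (f g : Ass k n) : (c • f) * g = c • (f * g) := by
  ext w; simp [Ass.mul_apply, mul_assoc, Finset.mul_sum]

theorem Ass.mul_smul' (c : k) (f g : Ass k n) : f * (c • g) = c • (f * g) := by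
  ext w; simp [Ass.mul_apply, mul_left_comm, Finset.mul_sum]

theorem Ass.lshift_mul (f g : Ass k n) (a : Fin n) :
    Ass.lshift a (f * g) = f [] • Ass.lshift a g + Ass.lshift a f * g := by
  ext w; exact Ass.mul_cons f g a w

theorem Ass.zero_mul' (f : Ass k n) : 0 * f = 0 := by
  ext w; simp [Ass.mul_apply]

theorem Ass.lshift_one (a : Fin n) : Ass.lshift a (1 : Ass k n) = 0 := by
  ext w; simp [Ass.lshift, Ass.one_apply]

theorem Ass.mul_assoc' (f g h : Ass k n) : f * g * h = f * (g * h) := by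
  ext w
  induction w generalizing f with
  | nil => simp [mul_assoc]
  | cons a w ih =>
    rw [Ass.mul_cons, Ass.lshift_mul, Ass.add_mul', Ass.smul_mul', Ass.add_apply, Ass.smul_apply,
      ih, Ass.mul_cons f, Ass.mul_cons g, Ass.mul_nil]
    ring

theorem Ass.one_mul' (f : Ass k n) : 1 * f = f := by
  ext w
  cases w with
  | nil => simp [Ass.one_apply]
  | cons a w => rw [Ass.mul_cons, Ass.lshift_one, Ass.zero_mul']; simp [Ass.one_apply]

theorem Ass.mul_one' (f : Ass k n) : f * 1 = f := by
  ext w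
  induction w generalizing f with
  | nil => simp [Ass.one_apply]
  | cons a w ih => rw [Ass.mul_cons, ih]; simp [Ass.one_apply, Ass.lshift]

instance : Ring (Ass k n) where
  __ := (inferInstance : AddCommGroup (Ass k n))
  mul_assoc := Ass.mul_assoc'
  one_mul := Ass.one_mul'
  mul_one := Ass.mul_one'
  left_distrib := Ass.mul_add'
  right_distrib := Ass.add_mul'
  zero_mul := Ass.zero_mul'
  mul_zero f := by ext w; simp [Ass.mul_apply]

instance : Algebra k (Ass k n) := Algebra.ofModule Ass.smul_mul' (fun c f g => Ass.mul_smul' c f g)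

/-- The commutator bracket `[f, g] = f g - g f`. -/
instance : LieRing (Ass k n) := LieRing.ofAssociativeRing

/-- The generators `x_1, …, x_n`. -/
def X (i : Fin n) : Ass k n := ⟨fun w => if w = [i] then 1 else 0⟩

/-- The homogeneous component of degree `d`. -/
def homog (d : ℕ) (f : Ass k n) : Ass k n := ⟨fun w => if w.length = d then f w else 0⟩

/-- The operator `∂_i` determined by `f = f₀ + ∑ i, (∂_i f) x_i`. -/
def partialR (i : Fin n) (f : Ass k n) : Ass k n := ⟨fun w => f (w ++ [i])⟩

variable (k n) in
/-- `lie_n`, the degree completion of the free Lie algebra on `x_1, …, x_n`, realized in `Ass_n`.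
The free Lie algebra is the Lie subalgebra of Lie polynomials, generated by the letters for
the commutator bracket; the completion consists of the series all of whose homogeneous components
are Lie polynomials. -/
def lie : Set (Ass k n) :=
  {f | ∀ d, homog d f ∈ LieSubalgebra.lieSpan k (Ass k n) (Set.range (X : Fin n → Ass k n))}

end Algebra

section Series

variable {k : Type*} [Field k] {m n : ℕ}

/-- For a series `f` without constant term, the sum `∑ c_r f ^ r` over all `r ≥ 0`; the terms
with `r > length w` do not contribute to the coefficient of `w`. -/
def evalSeries (c : ℕ → k) (f : Ass k n) : Ass k n :=
  ⟨fun w => ∑ r ∈ Finset.range (w.length + 1), c r * (f ^ r) w⟩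

/-- `e ^ f = ∑ f ^ r / r!`, for `f` without constant term. -/
def assExp (f : Ass k n) : Ass k n := evalSeries (fun r => (r.factorial : k)⁻¹) f

/-- `ln g = - ∑_{r ≥ 1} (1 - g) ^ r / r`, for `g` with constant term `1`. -/
def assLog (g : Ass k n) : Ass k n := - evalSeries (fun r => (r : k)⁻¹) (1 - g)

variable (k) in
/-- The Campbell–Hausdorff series `ch(x, y) = ln (e ^ x e ^ y)`. -/
def ch : Ass k 2 := assLog (assExp (X 0) * assExp (X 1))

/-- The product `s_{w_1} ⋯ s_{w_r}` for a word `w = w_1 ⋯ w_r`. -/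
def wordProd (s : Fin m → Ass k n) (w : List (Fin m)) : Ass k n := (w.map s).prod

theorem mul_apply_eq_zero {f g : Ass k n} {p q : ℕ} (hf : ∀ w, w.length < p → f w = 0)
    (hg : ∀ w, w.length < q → g w = 0) (w : List (Fin n)) (hw : w.length < p + q) :
    (f * g) w = 0 := by
  rw [Ass.mul_apply]
  refine Finset.sum_eq_zero fun i hi => ?_
  by_cases h : (w.take i).length < p
  · rw [hf _ h, zero_mul]
  · rw [hg, mul_zero]
    simp only [List.length_take, List.length_drop] at *
    omega

theorem wordProd_apply_eq_zero {s : Fin m → Ass k n} (hs : ∀ i, s i [] = 0) (v : List (Fin m))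
    (w : List (Fin n)) (h : w.length < v.length) : wordProd s v w = 0 := by
  induction v generalizing w with
  | nil => simp at h
  | cons a v ih =>
    have : wordProd s (a :: v) = s a * wordProd s v := by simp [wordProd]
    rw [this]
    refine mul_apply_eq_zero (p := 1) (q := v.length) ?_ ih w (by simp at h; omega)
    intro w hw
    have : w = [] := List.length_eq_zero_iff.1 (by omega)
    rw [this, hs]

/-- All words of length at most `N`. -/
def wordsLE (m N : ℕ) : Finset (List (Fin m)) :=
  (Finset.range (N + 1)).biUnion fun r => Finset.univ.image (List.ofFn : (Fin r → Fin m) → _)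

theorem mem_wordsLE {N : ℕ} {w : List (Fin m)} : w ∈ wordsLE m N ↔ w.length ≤ N := by
  simp only [wordsLE, Finset.mem_biUnion, Finset.mem_range, Finset.mem_image, Finset.mem_univ,
    true_and]
  constructor
  · rintro ⟨r, hr, v, rfl⟩
    simp; omega
  · intro h
    exact ⟨w.length, by omega, w.get, List.ofFn_get w⟩

/-- The substitution `f ↦ f(s_1, …, s_m)` for series `s_i` without constant term; words longer than
`w` do not contribute to the coefficient of `w`. -/
def substFun (s : Fin m → Ass k n) (f : Ass k m) : Ass k n :=
  ⟨fun w => ∑ v ∈ wordsLE m w.length, f v * wordProd s v w⟩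

theorem substFun_apply {s : Fin m → Ass k n} (hs : ∀ i, s i [] = 0) (f : Ass k m)
    (w : List (Fin n)) {N : ℕ} (hN : w.length ≤ N) :
    substFun s f w = ∑ v ∈ wordsLE m N, f v * wordProd s v w := by
  refine Finset.sum_subset (fun v hv => ?_) (fun v _ hv => ?_)
  · rw [mem_wordsLE] at *; omega
  · rw [mem_wordsLE] at hv
    rw [wordProd_apply_eq_zero hs _ _ (by omega), mul_zero]

theorem substFun_mul {s : Fin m → Ass k n} (hs : ∀ i, s i [] = 0) (f g : Ass k m) :
    substFun s (f * g) = substFun s f * substFun s g := by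
  ext w
  have key : ∀ v₁ v₂ : List (Fin m), wordProd s (v₁ ++ v₂) = wordProd s v₁ * wordProd s v₂ := by
    intro v₁ v₂; simp [wordProd]
  have h1 : substFun s (f * g) w = ∑ p ∈ wordsLE m w.length ×ˢ wordsLE m w.length,
      f p.1 * g p.2 * wordProd s (p.1 ++ p.2) w := by
    have : ∀ v ∈ wordsLE m w.length, (f * g) v * wordProd s v w =
        ∑ p ∈ (wordsLE m w.length ×ˢ wordsLE m w.length) with p.1 ++ p.2 = v,
          f p.1 * g p.2 * wordProd s (p.1 ++ p.2) w := by
      intro v hv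
      rw [mem_wordsLE] at hv
      rw [Ass.mul_apply, Finset.sum_mul]
      refine Finset.sum_bij' (fun i _ => (v.take i, v.drop i)) (fun p _ => p.1.length) ?_ ?_ ?_ ?_ ?_
      · intro i hi
        simp only [Finset.mem_filter, Finset.mem_product, mem_wordsLE, List.take_append_drop,
          List.length_take, List.length_drop, and_true]
        omega
      · rintro ⟨a, b⟩ hp
        simp only [Finset.mem_filter, Finset.mem_product, mem_wordsLE] at hp
        have := congrArg List.length hp.2
        simp only [List.length_append] at this
        simp only [Finset.mem_range]; omega
      · intro i hi
        simp only [Finset.mem_range] at hi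
        simp; omega
      · rintro ⟨a, b⟩ hp
        simp only [Finset.mem_filter] at hp
        simp [← hp.2]
      · intro i hi
        simp
    rw [show substFun s (f * g) w = ∑ v ∈ wordsLE m w.length, (f * g) v * wordProd s v w from rfl,
      Finset.sum_congr rfl this, Finset.sum_fiberwise_eq_sum_filter
      (wordsLE m w.length ×ˢ wordsLE m w.length) (wordsLE m w.length)]
    refine Finset.sum_subset (Finset.filter_subset _ _) fun p hp hp' => ?_
    have : w.length < (p.1 ++ p.2).length := by
      by_contra hlt
      exact hp' (Finset.mem_filter.2 ⟨hp, mem_wordsLE.2 (by omega)⟩)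
    rw [wordProd_apply_eq_zero hs _ _ this, mul_zero]
  rw [h1, Ass.mul_apply]
  have h2 : ∀ i ∈ Finset.range (w.length + 1), substFun s f (w.take i) * substFun s g (w.drop i) =
      ∑ p ∈ wordsLE m w.length ×ˢ wordsLE m w.length,
        f p.1 * g p.2 * (wordProd s p.1 (w.take i) * wordProd s p.2 (w.drop i)) := by
    intro i _
    rw [substFun_apply hs f (w.take i) (N := w.length) (by simp),
      substFun_apply hs g (w.drop i) (N := w.length) (by simp), Finset.sum_mul_sum,
      Finset.sum_product]
    exact Finset.sum_congr rfl fun _ _ => Finset.sum_congr rfl fun _ _ => by ring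
  rw [Finset.sum_congr rfl h2, Finset.sum_comm]
  refine Finset.sum_congr rfl fun p _ => ?_
  rw [key, Ass.mul_apply, Finset.mul_sum]

theorem substFun_one (s : Fin m → Ass k n) : substFun s 1 = 1 := by
  ext w
  rw [show substFun s 1 w = ∑ v ∈ wordsLE m w.length, (1 : Ass k m) v * wordProd s v w from rfl,
    Finset.sum_eq_single []]
  · simp [wordProd, Ass.one_apply]
  · intro v _ hv; simp [Ass.one_apply, hv]
  · intro h; exact absurd (mem_wordsLE.2 (by simp)) h

/-- Substitution of series without constant term, as an algebra homomorphism. -/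
def subst (s : Fin m → Ass k n) (hs : ∀ i, s i [] = 0) : Ass k m →ₐ[k] Ass k n :=
  AlgHom.ofLinearMap
    { toFun := substFun s
      map_add' := fun f g => by ext w; simp [substFun, add_mul, Finset.sum_add_distrib]
      map_smul' := fun c f => by ext w; simp [substFun, mul_assoc, Finset.mul_sum] }
    (substFun_one s) (substFun_mul hs)

theorem X_nil (i : Fin n) : (X i : Ass k n) [] = 0 := by simp [X]

theorem ch_nil : ch k [] = 0 := by
  simp [ch, assLog, evalSeries]

end Series

section Trace

variable {k : Type*} [Field k] {m n : ℕ}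

variable (k n) in
/-- The span of the commutators and of the constants. -/
def trKer : Submodule k (Ass k n) :=
  Submodule.span k ({1} ∪ {c | ∃ a b : Ass k n, c = a * b - b * a})

variable (k n) in
/-- `tr_n`, the quotient of `Ass_n⁺` (series without constant term) by the span of the commutators,
written as the quotient of `Ass_n = k ⊕ Ass_n⁺` by the constants and the span of the commutators. -/
abbrev tr : Type _ := Ass k n ⧸ trKer k n

/-- The projection `Tr : Ass_n → tr_n`. -/
def Tr : Ass k n →ₗ[k] tr k n := (trKer k n).mkQ

/-- The map `tr_m → tr_n` induced by an algebra homomorphism. -/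
def trMap (φ : Ass k m →ₐ[k] Ass k n) : tr k m →ₗ[k] tr k n :=
  (trKer k m).mapQ (trKer k n) φ.toLinearMap <| by
    rw [trKer, Submodule.span_le]
    rintro c (rfl | ⟨a, b, rfl⟩)
    · exact Submodule.subset_span (Or.inl (map_one φ))
    · exact Submodule.subset_span (Or.inr ⟨φ a, φ b, by simp⟩)

variable (k) in
/-- `δ : tr_2 → tr_3`, `(δ f)(x, y, z) = f(y, z) - f(x + y, z) + f(x, y + z) - f(x, y)`. -/
def delta : tr k 2 →ₗ[k] tr k 3 :=
  trMap (subst ![X 1, X 2] (by simp [Fin.forall_fin_two, X_nil]))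
    - trMap (subst ![X 0 + X 1, X 2] (by simp [Fin.forall_fin_two, X_nil]))
    + trMap (subst ![X 0, X 1 + X 2] (by simp [Fin.forall_fin_two, X_nil]))
    - trMap (subst ![X 0, X 1] (by simp [Fin.forall_fin_two, X_nil]))

variable (k) in
/-- `δ̃ : tr_1 → tr_2`, `(δ̃ f)(x, y) = f(y) - f(ch(x, y)) + f(x)`. -/
def deltaTilde : tr k 1 →ₗ[k] tr k 2 :=
  trMap (subst ![X 1] (by simp [X_nil]))
    - trMap (subst ![ch k] (by simp [ch_nil]))
    + trMap (subst ![X 0] (by simp [X_nil]))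

end Trace

section Derivations

variable (k : Type*) [Field k] (n : ℕ)

/-- A tangential derivation of `lie_n`, given together with its (automatically continuous, and
unique) extension to a derivation of `Ass_n`: `u(x_i) = [x_i, a_i]` with `a_i ∈ lie_n`. The tuple
`(a_1, …, a_n)` is normalized (`a_i` has no term in `x_i`), so that it is determined by `u`. -/
@[ext] structure TDer where
  /-- The derivation, acting on `Ass_n`. -/
  toEnd : Module.End k (Ass k n)
  /-- The components `a_1, …, a_n`. -/
  comp : Fin n → Ass k n
  leibniz : ∀ f g, toEnd (f * g) = toEnd f * g + f * toEnd g
  comp_mem : ∀ i, comp i ∈ lie k n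
  normalized : ∀ i, comp i [i] = 0
  map_X : ∀ i, toEnd (X i) = X i * comp i - comp i * X i

variable {k n}

/-- The operator `∑ c_r D ^ r` over all `r ≥ 0`, for an operator `D` on `Ass_n` which raises
the degree by at least one; the terms with `r > length w` do not contribute to the coefficient
of `w`. -/
def opSeries (c : ℕ → k) (D : Module.End k (Ass k n)) : Module.End k (Ass k n) where
  toFun f := ⟨fun w => ∑ r ∈ Finset.range (w.length + 1), c r * ((D ^ r) f) w⟩
  map_add' f g := by
    ext w
    simp [mul_add, Finset.sum_add_distrib]
  map_smul' c f := by
    ext w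
    simp [mul_left_comm, Finset.mul_sum]

namespace TDer

theorem comp_nil (u : TDer k n) (i : Fin n) : u.comp i [] = 0 := by
  have key : LieSubalgebra.lieSpan k (Ass k n) (Set.range X) ≤
      { carrier := {f : Ass k n | f [] = 0}
        add_mem' := fun {a b} ha hb => by
          simp only [Set.mem_ofPred_eq] at *; rw [Ass.add_apply, ha, hb, add_zero]
        zero_mem' := rfl
        smul_mem' := fun c f hf => by
          simp only [Set.mem_ofPred_eq] at *; rw [Ass.smul_apply, hf, mul_zero]
        lie_mem' := fun {a b} _ _ => by
          change (a * b - b * a) [] = 0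
          rw [Ass.sub_apply, Ass.mul_nil, Ass.mul_nil, mul_comm, sub_self] } := by
    rw [LieSubalgebra.lieSpan_le]
    rintro _ ⟨i, rfl⟩
    exact X_nil i
  have : homog 0 (u.comp i) [] = 0 := key (u.comp_mem i 0)
  simpa [homog] using this

/-- Tangential derivations raise the degree. -/
theorem toEnd_apply_eq_zero (u : TDer k n) (f : Ass k n) (p : ℕ)
    (hf : ∀ w, w.length < p → f w = 0) (w : List (Fin n)) (hw : w.length < p + 1) :
    u.toEnd f w = 0 := by
  have h1 : u.toEnd 1 = 0 := by simpa using u.leibniz 1 1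
  have hX : ∀ i v, v.length < 1 → (X i : Ass k n) v = 0 := by
    intro i v hv
    rw [List.length_eq_zero_iff.1 (by omega : v.length = 0), X_nil]
  have ha : ∀ i v, v.length < 1 → u.comp i v = 0 := by
    intro i v hv
    rw [List.length_eq_zero_iff.1 (by omega : v.length = 0), u.comp_nil]
  have hdX : ∀ i v, v.length < 2 → u.toEnd (X i) v = 0 := by
    intro i v hv
    rw [u.map_X, Ass.sub_apply, mul_apply_eq_zero (hX i) (ha i) v hv,
      mul_apply_eq_zero (ha i) (hX i) v hv, sub_zero]
  have hdec : ∀ f : Ass k n, f = f [] • 1 + ∑ i, X i * Ass.lshift i f := by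
    intro f
    have hsh : ∀ i j : Fin n, Ass.lshift j (X i : Ass k n) = if i = j then 1 else 0 := by
      intro i j
      ext v
      by_cases h : i = j
      · subst h; simp [Ass.lshift, X, Ass.one_apply]
      · simp [Ass.lshift, X, h, Ne.symm h]
    ext v
    rw [Ass.add_apply, Ass.smul_apply, Ass.sum_apply, Ass.one_apply]
    cases v with
    | nil => simp [X_nil]
    | cons a v =>
      simp only [Ass.mul_cons, hsh, X_nil]
      rw [Finset.sum_eq_single a]
      · simp [Ass.lshift]
      · intro b _ hb; simp [hb]
      · simp
  have hD : ∀ f : Ass k n, u.toEnd f =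
      ∑ i, (u.toEnd (X i) * Ass.lshift i f + X i * u.toEnd (Ass.lshift i f)) := by
    intro f
    conv_lhs => rw [hdec f]
    rw [map_add, map_smul, h1, smul_zero, zero_add, map_sum]
    exact Finset.sum_congr rfl fun i _ => u.leibniz _ _
  induction p generalizing f w with
  | zero =>
    rw [List.length_eq_zero_iff.1 (by omega : w.length = 0), hD, Ass.sum_apply]
    refine Finset.sum_eq_zero fun i _ => ?_
    simp [X_nil, hdX i []]
  | succ p ih =>
    rw [hD, Ass.sum_apply]
    refine Finset.sum_eq_zero fun i _ => ?_
    have hsh : ∀ v : List (Fin n), v.length < p → Ass.lshift i f v = 0 := fun v hv =>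
      hf _ (by simp only [List.length_cons]; omega)
    rw [Ass.add_apply, mul_apply_eq_zero (hdX i) hsh w (by omega),
      mul_apply_eq_zero (hX i) (ih _ hsh) w (by omega), zero_add]

theorem pow_toEnd_apply_eq_zero (u : TDer k n) (f : Ass k n) (r : ℕ) (w : List (Fin n))
    (hw : w.length < r) : (u.toEnd ^ r) f w = 0 := by
  induction r generalizing w with
  | zero => omega
  | succ r ih =>
    rw [pow_succ', Module.End.mul_apply]
    exact u.toEnd_apply_eq_zero _ r ih w hw

/-- The automorphism `exp(u) = ∑ u ^ r / r!`. -/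
def exp (u : TDer k n) : Module.End k (Ass k n) :=
  opSeries (fun r => (r.factorial : k)⁻¹) u.toEnd

/-- The series `∑ i, x_i (∂_i a_i)`, whose trace is the divergence. -/
def divRep (u : TDer k n) : Ass k n := ∑ i, X i * partialR i (u.comp i)

/-- The divergence `div(u) = ∑ i, Tr (x_i (∂_i a_i))`. -/
def div (u : TDer k n) : tr k n := Tr u.divRep

/-- The group cocycle `j` integrating `div`, at `exp(u)`:
`j(exp(u)) = ((e ^ u - 1) / u) · div(u) = ∑ u ^ r · div(u) / (r + 1)!`.
The action on `tr_n` is the one induced by the action on `Ass_n`. -/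
def j (u : TDer k n) : tr k n :=
  Tr (opSeries (fun r => ((r + 1).factorial : k)⁻¹) u.toEnd u.divRep)

end TDer

variable (k)

/-- The Lie algebra `sder_2` of special derivations: `u(x + y) = 0`. -/
def sder2 : Set (TDer k 2) := {u | u.toEnd (X 0 + X 1) = 0}

/-- `hkv_2`, the special derivations whose divergence is in the kernel of `δ`. -/
def hkv2 : Set (TDer k 2) := {u | u ∈ sder2 k ∧ u.div ∈ LinearMap.ker (delta k)}

/-- `HKV_2 = exp(hkv_2)`, as a set of automorphisms (the product is composition). -/
def HKV2 : Set (Module.End k (Ass k 2)) := TDer.exp '' hkv2 k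

/-- The set of solutions `F = exp(u)`, with `u` a tangential derivation, of the generalized
Kashiwara–Vergne problem: `F(x + y) = ch(x, y)` and `j(F) ∈ im(δ̃)`. -/
def SolHKV : Set (Module.End k (Ass k 2)) :=
  {F | ∃ u : TDer k 2, F = u.exp ∧ F (X 0 + X 1) = ch k ∧ u.j ∈ LinearMap.range (deltaTilde k)}

end Derivations

end KashiwaraVergne

end

noncomputable section

namespace KashiwaraVergne

/-! `HKV2` and `SolHKV` are cut out of the exponentials of tangential derivations by two conditions,
one on the image of x + y and one on j. The theorem rests on two facts: these exponentials are
closed under composition, and j is a cocycle, j(FG) = j(F) + F·j(G). Both are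
`TDer.exists_exp_eq_mul`.

They come from a single use of the Baker–Campbell–Hausdorff theorem. Let u act on k ⊕ Ass⁺ as a
derivation that in addition sends 1 to its divergence. Modulo commutators this respects brackets,
because the divergence is a Lie algebra cocycle (`TDer.divRep_bracket`), and its exponential sends 1
to 1 + j(exp u) (`TDer.exp_affine_one`). Running BCH simultaneously for the derivations and for
these affine operators yields w with exp w = exp u exp v, and comparing values at 1 yields the
cocycle identity. BCH is proved for the formal product e^{tu} e^{tv} (`exists_exp_eq_expT_mul`) and
specialized at t = 1 by completeness; traces survive the infinite sums because `trKer` is closed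
(`mem_trKer_iff`).

The conditions on j are compared through Dh = h(y) - h(x + y) + h(x) (`addCoboundary`). The kernel
of δ consists exactly of the classes of the Dh (`delta_addCoboundary`,
`exists_Tr_eq_of_delta_eq_zero`). A tangential derivation acts on series in one letter as an inner
derivation. Hence, if u(x + y) = 0, then u kills Dh in tr_2, and div u = Dh is equivalent to j(exp
u) = Dh (`mem_HKV2_iff`). If instead F(x + y) = ch, then F·Dh = δ̃h in tr_2
(`TDer.Tr_exp_addCoboundary`).

So for a solution F and g in HKV_2, j(Fg) = j(F) + F·Dh stays in the image of δ̃. For two solutions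
F and G, the automorphism F⁻¹G fixes x + y, and j(F⁻¹G) = F⁻¹·(j(G) - j(F)) is the class of some Dh,
which gives transitivity. Freeness is the invertibility of F. -/

/-- A complete and separated multiplicative filtration on a ring `A`, with a choice of the
sums of the series `∑ a_r` such that `a_r` lies in the `r`-th step of the filtration. -/
class CompleteFiltration (A : Type*) [Ring A] where
  /-- The steps of the filtration. -/
  fil : ℕ → AddSubgroup A
  anti : Antitone fil
  one_mem : (1 : A) ∈ fil 0
  mul_mem : ∀ {m n : ℕ} {a b : A}, a ∈ fil m → b ∈ fil n → a * b ∈ fil (m + n)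
  eq_zero_of_mem : ∀ {a : A}, (∀ n, a ∈ fil n) → a = 0
  /-- The sum of a series. -/
  lsum : (ℕ → A) → A
  lsum_sub_mem : ∀ {a : ℕ → A}, (∀ n, a n ∈ fil n) →
    ∀ N, lsum a - ∑ n ∈ Finset.range N, a n ∈ fil N

open CompleteFiltration

/-- Stability of the steps of a filtration under scalars. -/
class FiltrationSMul (k A : Type*) [Field k] [Ring A] [Algebra k A] [CompleteFiltration A] :
    Prop where
  smul_mem : ∀ (c : k) {n : ℕ} {a : A}, a ∈ fil n → c • a ∈ fil n

/-! ### Convergent sums and power series in complete filtered rings -/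

section Filtration

variable {k A B : Type*} [Field k] [Ring A] [Algebra k A] [CompleteFiltration A]
  [FiltrationSMul k A] [Ring B] [Algebra k B] [CompleteFiltration B]

theorem eq_of_sub_mem_fil {a b : A} (h : ∀ n, a - b ∈ fil n) : a = b :=
  sub_eq_zero.1 (eq_zero_of_mem h)

theorem fil_le {a : A} {m n : ℕ} (h : m ≤ n) (ha : a ∈ fil n) : a ∈ fil m := anti h ha

theorem lsum_mem_zero {a : ℕ → A} (ha : ∀ n, a n ∈ fil n) : lsum a ∈ fil 0 := by
  simpa using lsum_sub_mem ha 0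

theorem eq_lsum {a : ℕ → A} (ha : ∀ n, a n ∈ fil n) {s : A}
    (hs : ∀ N, s - ∑ n ∈ Finset.range N, a n ∈ fil N) : s = lsum a :=
  eq_of_sub_mem_fil fun N => by simpa using sub_mem (hs N) (lsum_sub_mem ha N)

theorem lsum_mem {a : ℕ → A} (ha : ∀ n, a n ∈ fil n) {N : ℕ} (h : ∀ n < N, a n = 0) :
    lsum a ∈ fil N := by
  have := lsum_sub_mem ha N
  rwa [Finset.sum_eq_zero fun n hn => h n (Finset.mem_range.1 hn), sub_zero] at this

theorem map_lsum (φ : A →+ B) (hφ : ∀ n, ∀ a ∈ fil n, φ a ∈ fil n) {a : ℕ → A}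
    (ha : ∀ n, a n ∈ fil n) : φ (lsum a) = lsum fun n => φ (a n) :=
  eq_lsum (fun n => hφ n _ (ha n)) fun N => by
    rw [← map_sum, ← map_sub]
    exact hφ N _ (lsum_sub_mem ha N)

theorem lsum_add {a b : ℕ → A} (ha : ∀ n, a n ∈ fil n) (hb : ∀ n, b n ∈ fil n) :
    lsum (fun n => a n + b n) = lsum a + lsum b :=
  (eq_lsum (fun n => add_mem (ha n) (hb n)) fun N => by
    rw [Finset.sum_add_distrib, add_sub_add_comm]
    exact add_mem (lsum_sub_mem ha N) (lsum_sub_mem hb N)).symm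

theorem lsum_single {a : ℕ → A} (ha : ∀ n, a n ∈ fil n) {m : ℕ} (h : ∀ n ≠ m, a n = 0) :
    lsum a = a m :=
  (eq_lsum ha fun N => by
    by_cases hN : m < N
    · rw [Finset.sum_eq_single m (fun n _ hn => h n hn) (by simp [hN]), sub_self]
      exact zero_mem _
    · rw [Finset.sum_eq_zero fun n hn => h n (by rintro rfl; exact hN (Finset.mem_range.1 hn)),
        sub_zero]
      exact fil_le (by omega) (ha m)).symm

/-- Removing the triangle i + j < N from the square of products leaves the pairs with i, j < N and i
+ j ≥ N, whose products lie in step N. -/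
theorem sum_mul_sum_sub_mem {a b : ℕ → A} (ha : ∀ n, a n ∈ fil n) (hb : ∀ n, b n ∈ fil n)
    (N : ℕ) :
    (∑ n ∈ Finset.range N, a n) * (∑ n ∈ Finset.range N, b n) -
      ∑ n ∈ Finset.range N, ∑ p ∈ Finset.HasAntidiagonal.antidiagonal n, a p.1 * b p.2 ∈ fil N := by
  have h1 : ∑ n ∈ Finset.range N, ∑ p ∈ Finset.HasAntidiagonal.antidiagonal n, a p.1 * b p.2 =
      ∑ i ∈ Finset.range N, ∑ j ∈ Finset.range (N - i), a i * b j := by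
    rw [← Finset.sum_range_diag_flip N fun i j => a i * b j]
    exact Finset.sum_congr rfl fun n _ =>
      Finset.Nat.sum_antidiagonal_eq_sum_range_succ (fun i j => a i * b j) n
  rw [h1, Finset.sum_mul_sum, ← Finset.sum_sub_distrib]
  refine sum_mem fun i hi => ?_
  rw [← Finset.sum_sdiff (Finset.range_subset_range.2 (Nat.sub_le N i)), add_sub_cancel_right]
  refine sum_mem fun j hj => fil_le ?_ (mul_mem (ha i) (hb j))
  simp only [Finset.mem_sdiff, Finset.mem_range] at hj hi
  omega

theorem antidiagonal_mem {a b : ℕ → A} (ha : ∀ n, a n ∈ fil n) (hb : ∀ n, b n ∈ fil n) (n : ℕ) :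
    ∑ p ∈ Finset.HasAntidiagonal.antidiagonal n, a p.1 * b p.2 ∈ fil n :=
  sum_mem fun p hp => Finset.HasAntidiagonal.mem_antidiagonal.1 hp ▸ mul_mem (ha p.1) (hb p.2)

/-- The Cauchy product of series. -/
theorem lsum_mul_lsum {a b : ℕ → A} (ha : ∀ n, a n ∈ fil n) (hb : ∀ n, b n ∈ fil n) :
    lsum a * lsum b = lsum fun n => ∑ p ∈ Finset.HasAntidiagonal.antidiagonal n, a p.1 * b p.2 := by
  refine eq_lsum (antidiagonal_mem ha hb) fun N => ?_
  have h2 : ∑ n ∈ Finset.range N, a n ∈ fil 0 :=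
    sum_mem fun n _ => fil_le (Nat.zero_le n) (ha n)
  have h3 := mul_mem (lsum_sub_mem ha N) (lsum_mem_zero hb)
  have h4 := mul_mem h2 (lsum_sub_mem hb N)
  rw [zero_add] at h4
  rw [add_zero] at h3
  have := add_mem (add_mem h3 h4) (sum_mul_sum_sub_mem ha hb N)
  convert this using 1
  noncomm_ring

theorem pow_mem_fil {a : A} (ha : a ∈ fil 1) (r : ℕ) : a ^ r ∈ fil r := by
  induction r with
  | zero => simpa using CompleteFiltration.one_mem
  | succ r ih => rw [pow_succ]; exact mul_mem ih ha

/-- The value `∑ c_r a ^ r` of a power series at `a`. -/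
def ser (P : PowerSeries k) (a : A) : A := lsum fun r => PowerSeries.coeff r P • a ^ r

theorem ser_term_mem (P : PowerSeries k) {a : A} (ha : a ∈ fil 1) (r : ℕ) :
    PowerSeries.coeff r P • a ^ r ∈ fil r :=
  FiltrationSMul.smul_mem _ (pow_mem_fil ha r)

theorem ser_mul (P Q : PowerSeries k) {a : A} (ha : a ∈ fil 1) :
    ser (P * Q) a = ser P a * ser Q a := by
  unfold ser
  rw [lsum_mul_lsum (ser_term_mem P ha) (ser_term_mem Q ha)]
  congr 1
  funext n
  rw [PowerSeries.coeff_mul, Finset.sum_smul]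
  refine Finset.sum_congr rfl fun p hp => ?_
  rw [← Finset.HasAntidiagonal.mem_antidiagonal.1 hp, pow_add, smul_mul_smul_comm]

theorem ser_one {a : A} (ha : a ∈ fil 1) : ser (1 : PowerSeries k) a = 1 := by
  unfold ser
  rw [lsum_single (m := 0) (ser_term_mem 1 ha) (fun n hn => by simp [PowerSeries.coeff_one, hn])]
  simp

theorem ser_X {a : A} (ha : a ∈ fil 1) : ser (PowerSeries.X : PowerSeries k) a = a := by
  unfold ser
  rw [lsum_single (m := 1) (ser_term_mem _ ha) (fun n hn => by simp [PowerSeries.coeff_X, hn])]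
  simp

theorem ser_add (P Q : PowerSeries k) {a : A} (ha : a ∈ fil 1) :
    ser (P + Q) a = ser P a + ser Q a := by
  unfold ser
  rw [← lsum_add (ser_term_mem P ha) (ser_term_mem Q ha)]
  simp [add_smul]

theorem map_ser (φ : A →+* B) (hφ : ∀ n, ∀ a ∈ fil n, φ a ∈ fil n)
    (hs : ∀ (c : k) (a : A), φ (c • a) = c • φ a) (P : PowerSeries k) {a : A} (ha : a ∈ fil 1) :
    φ (ser P a) = ser P (φ a) := by
  have := map_lsum φ.toAddMonoidHom hφ (ser_term_mem P ha)
  simpa [ser, hs] using this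

variable (k) in
/-- The exponential series. -/
def expS : PowerSeries k := PowerSeries.mk fun r => (r.factorial : k)⁻¹

variable (k) in
/-- The series of `(e ^ x - 1) / x`. -/
def phiS : PowerSeries k := PowerSeries.mk fun r => ((r + 1).factorial : k)⁻¹

variable (k) in
theorem X_mul_phiS : (PowerSeries.X : PowerSeries k) * phiS k + 1 = expS k := by
  ext n
  cases n with
  | zero => simp [expS]
  | succ n => simp [expS, phiS, PowerSeries.coeff_succ_X_mul, PowerSeries.coeff_one]

omit [FiltrationSMul k A] in
theorem ser_evalNeg (P : PowerSeries k) (a : A) :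
    ser P (-a) = ser (PowerSeries.evalNegHom P) a := by
  unfold ser
  congr 1
  funext r
  rw [neg_pow, PowerSeries.evalNegHom, PowerSeries.coeff_rescale]
  rcases Nat.even_or_odd r with h | h <;> simp [h.neg_one_pow]

end Filtration

/-! ### Filtrations on series, operators and formal power series -/

section Instances

variable {k : Type*} [Field k] {n : ℕ}

/-- Truncating at the length of the word makes the sum total, with no convergence hypothesis, and
makes `opSeries` definitionally a value of `ser`. -/
instance : CompleteFiltration (Ass k n) where
  fil N :=
    { carrier := {f | ∀ w, w.length < N → f w = 0}
      add_mem' := fun {a b} ha hb w hw => by rw [Ass.add_apply, ha w hw, hb w hw, add_zero]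
      zero_mem' := fun _ _ => rfl
      neg_mem' := fun {f} hf w hw => by rw [Ass.neg_apply, hf w hw, neg_zero] }
  anti M N h f hf w hw := hf w (by omega)
  one_mem w hw := by omega
  mul_mem ha hb w hw := mul_apply_eq_zero ha hb w hw
  eq_zero_of_mem h := Ass.ext (funext fun w => h (w.length + 1) w (by omega))
  lsum a := ⟨fun w => ∑ r ∈ Finset.range (w.length + 1), a r w⟩
  lsum_sub_mem {a} ha N w hw := by
    rw [Ass.sub_apply, Ass.sum_apply, sub_eq_zero]
    refine Finset.sum_subset (Finset.range_subset_range.2 (by omega)) fun r hr hr' => ?_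
    exact ha r w (by simp at hr'; omega)

instance : FiltrationSMul k (Ass k n) :=
  ⟨fun c _ _ hf w hw => by rw [Ass.smul_apply, hf w hw, mul_zero]⟩

theorem Ass.mem_fil_zero (f : Ass k n) : f ∈ fil 0 := fun _ hw => by omega

theorem Ass.mem_fil_one {f : Ass k n} : f ∈ fil 1 ↔ f [] = 0 :=
  ⟨fun h => h [] (by simp), fun h w hw => by
    rw [List.length_eq_zero_iff.1 (by omega : w.length = 0), h]⟩

theorem Ass.lsum_apply (a : ℕ → Ass k n) (w : List (Fin n)) :
    lsum a w = ∑ r ∈ Finset.range (w.length + 1), a r w := rfl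

instance : CompleteFiltration (Module.End k (Ass k n)) where
  fil N :=
    { carrier := {T | ∀ p, ∀ f : Ass k n, f ∈ fil p → T f ∈ fil (p + N)}
      add_mem' := fun {a b} ha hb p f hf => add_mem (ha p f hf) (hb p f hf)
      zero_mem' := fun _ _ _ => zero_mem _
      neg_mem' := fun {T} hT p f hf => neg_mem (hT p f hf) }
  anti M N h T hT p f hf := fil_le (by omega) (hT p f hf)
  one_mem p f hf := hf
  mul_mem {m n a b} ha hb p f hf := by
    have := ha _ _ (hb p f hf)
    rwa [add_assoc, add_comm n m] at this
  eq_zero_of_mem h := LinearMap.ext fun f => eq_zero_of_mem fun N => by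
    simpa using h N 0 f (Ass.mem_fil_zero f)
  lsum a :=
    { toFun := fun f => lsum fun r => a r f
      map_add' := fun f g => by ext w; simp [Ass.lsum_apply, Finset.sum_add_distrib]
      map_smul' := fun c f => by ext w; simp [Ass.lsum_apply, Finset.mul_sum] }
  lsum_sub_mem {a} ha N p f hf w hw := by
    rw [LinearMap.sub_apply, LinearMap.sum_apply, Ass.sub_apply, Ass.sum_apply]
    change ∑ r ∈ Finset.range (w.length + 1), a r f w - _ = 0
    have h0 : ∀ r, w.length < p + r → a r f w = 0 := fun r hr => ha r p f hf w hr
    rw [sub_eq_zero]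
    -- The cut-off N and the cut-off built into the sum are unrelated; both truncations are compared
    -- with the one at their maximum.
    have h1 : ∀ M, N ≤ M → ∑ r ∈ Finset.range M, a r f w = ∑ r ∈ Finset.range N, a r f w := by
      intro M hM
      refine (Finset.sum_subset (Finset.range_subset_range.2 hM) fun r _ hr' => ?_).symm
      exact h0 r (by simp at hr'; omega)
    have h2 : ∀ M, w.length + 1 ≤ M →
        ∑ r ∈ Finset.range M, a r f w = ∑ r ∈ Finset.range (w.length + 1), a r f w := by
      intro M hM
      refine (Finset.sum_subset (Finset.range_subset_range.2 hM) fun r _ hr' => ?_).symm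
      exact h0 r (by simp at hr'; omega)
    rw [← h1 (max N (w.length + 1)) (le_max_left _ _), h2 _ (le_max_right _ _)]

instance : FiltrationSMul k (Module.End k (Ass k n)) :=
  ⟨fun c _ _ hT p f hf => FiltrationSMul.smul_mem c (hT p f hf)⟩

theorem End.lsum_apply (a : ℕ → Module.End k (Ass k n)) (f : Ass k n) :
    lsum a f = lsum fun r => a r f := rfl

theorem End.apply_mem {T : Module.End k (Ass k n)} {N : ℕ} (hT : T ∈ fil N) (f : Ass k n) :
    T f ∈ fil N := by simpa using hT 0 f (Ass.mem_fil_zero f)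

theorem opSeries_eq_ser (P : PowerSeries k) (D : Module.End k (Ass k n)) :
    opSeries (fun r => PowerSeries.coeff r P) D = ser P D := rfl

variable {R : Type*} [Ring R] [Algebra k R]

instance : CompleteFiltration (PowerSeries R) where
  fil N :=
    { carrier := {f | ∀ m < N, PowerSeries.coeff m f = 0}
      add_mem' := fun {a b} ha hb m hm => by rw [map_add, ha m hm, hb m hm, add_zero]
      zero_mem' := fun _ _ => map_zero _
      neg_mem' := fun {f} hf m hm => by rw [map_neg, hf m hm, neg_zero] }
  anti M N h f hf m hm := hf m (by omega)
  one_mem m hm := by omega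
  mul_mem {m n a b} ha hb r hr := by
    rw [PowerSeries.coeff_mul]
    refine Finset.sum_eq_zero fun p hp => ?_
    have := Finset.HasAntidiagonal.mem_antidiagonal.1 hp
    by_cases h : p.1 < m
    · rw [ha _ h, zero_mul]
    · rw [hb _ (by omega), mul_zero]
  eq_zero_of_mem h := PowerSeries.ext fun m => h (m + 1) m (by omega)
  lsum a := PowerSeries.mk fun m => ∑ r ∈ Finset.range (m + 1), PowerSeries.coeff m (a r)
  lsum_sub_mem {a} ha N m hm := by
    rw [map_sub, map_sum, PowerSeries.coeff_mk, sub_eq_zero]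
    refine Finset.sum_subset (Finset.range_subset_range.2 (by omega)) fun r hr hr' => ?_
    exact ha r m (by simp at hr'; omega)

instance : FiltrationSMul k (PowerSeries R) :=
  ⟨fun c _ _ hf m hm => by rw [PowerSeries.coeff_smul, hf m hm, smul_zero]⟩

theorem coeff_lsum (a : ℕ → PowerSeries R) (m : ℕ) : PowerSeries.coeff m (lsum a) =
    ∑ r ∈ Finset.range (m + 1), PowerSeries.coeff m (a r) := PowerSeries.coeff_mk _ _

end Instances

/-! ### Powers and iterated commutators along the filtration -/

section Filtration

variable {A : Type*} [Ring A] [CompleteFiltration A]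

theorem lsum_sub_lsum_mem {a b : ℕ → A} (ha : ∀ n, a n ∈ fil n) (hb : ∀ n, b n ∈ fil n) {N : ℕ}
    (h : ∀ n, a n - b n ∈ fil N) : lsum a - lsum b ∈ fil N := by
  have := add_mem (sub_mem (lsum_sub_mem ha N) (lsum_sub_mem hb N))
    (sum_mem fun n (_ : n ∈ Finset.range N) => h n)
  rw [Finset.sum_sub_distrib] at this
  convert this using 1
  abel

theorem lsum_shift {a : ℕ → A} (ha : ∀ n, a n ∈ fil n) (h0 : a 0 = 0) :
    lsum a = lsum fun n => a (n + 1) :=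
  eq_lsum (fun n => fil_le (Nat.le_succ n) (ha (n + 1))) fun N => by
    have := lsum_sub_mem ha (N + 1)
    rw [Finset.sum_range_succ', h0, add_zero] at this
    exact fil_le (Nat.le_succ N) this

/-- Telescoping: every factor beyond the first gains one step. This gain is the contraction used to
solve for a logarithm. -/
theorem pow_sub_pow_mem {a b : A} {n : ℕ} (ha : a ∈ fil 1) (hb : b ∈ fil 1) (h : a - b ∈ fil n)
    (r : ℕ) : a ^ (r + 1) - b ^ (r + 1) ∈ fil (n + r) := by
  induction r with
  | zero => simpa using h
  | succ r ih =>
    have h1 := mul_mem ih ha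
    have h2 := mul_mem (pow_mem_fil hb (r + 1)) h
    rw [add_comm] at h2
    have := add_mem h1 h2
    rw [pow_succ a (r + 1), pow_succ b (r + 1)]
    have e : a ^ (r + 1) * a - b ^ (r + 1) * b =
        (a ^ (r + 1) - b ^ (r + 1)) * a + b ^ (r + 1) * (a - b) := by noncomm_ring
    rw [e]
    exact this

/-- The iterated commutators `[a, [a, …, [a, b]]]`. -/
def iterBracket {R : Type*} [Ring R] (a b : R) (r : ℕ) : R := (fun y => a * y - y * a)^[r] b

theorem iterBracket_zero {R : Type*} [Ring R] (a b : R) : iterBracket a b 0 = b := rfl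

theorem iterBracket_succ {R : Type*} [Ring R] (a b : R) (r : ℕ) :
    iterBracket a b (r + 1) = a * iterBracket a b r - iterBracket a b r * a :=
  Function.iterate_succ_apply' _ _ _

theorem iterBracket_mem {a b : A} {n : ℕ} (ha : a ∈ fil 1) (hb : b ∈ fil n) (r : ℕ) :
    iterBracket a b r ∈ fil (n + r) := by
  induction r with
  | zero => exact hb
  | succ r ih =>
    rw [iterBracket_succ]
    have := mul_mem ha ih
    rw [add_comm 1] at this
    exact sub_mem this (by simpa [add_assoc] using CompleteFiltration.mul_mem ih ha)

end Filtration

/-! ### The Baker–Campbell–Hausdorff theorem over formal power series -/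

section Formal

variable {k : Type*} [Field k] [CharZero k] {R : Type*} [Ring R] [Algebra k R]

/-- Conjugation by the exponential is the exponential of the adjoint action. -/
theorem divPow_mul (u v : R) (n : ℕ) : ((n.factorial : k)⁻¹ • u ^ n) * v =
    ∑ p ∈ Finset.HasAntidiagonal.antidiagonal n,
      ((p.1.factorial : k)⁻¹ • iterBracket u v p.1) * ((p.2.factorial : k)⁻¹ • u ^ p.2) := by
  set q : ℕ → R := fun j => (j.factorial : k)⁻¹ • u ^ j with hq
  set c : ℕ → R := fun i => (i.factorial : k)⁻¹ • iterBracket u v i with hc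
  have hq1 : ∀ j, u * q j = ((j + 1 : ℕ) : k) • q (j + 1) := fun j => by
    have : ((j + 1 : ℕ) : k) ≠ 0 := Nat.cast_ne_zero.2 (by omega)
    simp only [hq]
    rw [mul_smul_comm, ← pow_succ', smul_smul, Nat.factorial_succ, Nat.cast_mul, mul_inv,
      mul_inv_cancel_left₀ this]
  have hc1 : ∀ i, u * c i = c i * u + ((i + 1 : ℕ) : k) • c (i + 1) := fun i => by
    have : ((i + 1 : ℕ) : k) ≠ 0 := Nat.cast_ne_zero.2 (by omega)
    simp only [hc]
    rw [mul_smul_comm, smul_mul_assoc, smul_smul, Nat.factorial_succ, Nat.cast_mul, mul_inv,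
      mul_inv_cancel_left₀ this, ← smul_add, iterBracket_succ]
    congr 1
    abel
  change q n * v = ∑ p ∈ Finset.HasAntidiagonal.antidiagonal n, c p.1 * q p.2
  induction n with
  | zero => simp [hq, hc, iterBracket_zero]
  | succ n ih =>
    have h0 : ((n + 1 : ℕ) : k) ≠ 0 := Nat.cast_ne_zero.2 (by omega)
    -- Both sides are compared after multiplication by n + 1. On the right n + 1 = i + j splits each
    -- term in two, matching the two terms produced by moving u past `c i`.
    refine smul_right_injective R h0 ?_
    change ((n + 1 : ℕ) : k) • (q (n + 1) * v) = ((n + 1 : ℕ) : k) • _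
    rw [← smul_mul_assoc, ← hq1, mul_assoc, ih, Finset.mul_sum, Finset.smul_sum]
    have e1 : ∀ p ∈ Finset.HasAntidiagonal.antidiagonal n, u * (c p.1 * q p.2) =
        ((p.2 + 1 : ℕ) : k) • (c p.1 * q (p.2 + 1)) +
          ((p.1 + 1 : ℕ) : k) • (c (p.1 + 1) * q p.2) := fun p _ => by
      rw [← mul_assoc, hc1, add_mul, mul_assoc, hq1, mul_smul_comm, smul_mul_assoc _ (c (p.1 + 1))]
    have e2 : ∀ p ∈ Finset.HasAntidiagonal.antidiagonal (n + 1),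
        ((n + 1 : ℕ) : k) • (c p.1 * q p.2) =
          (p.2 : k) • (c p.1 * q p.2) + (p.1 : k) • (c p.1 * q p.2) := fun p hp => by
      rw [← Finset.HasAntidiagonal.mem_antidiagonal.1 hp, Nat.cast_add, add_smul, add_comm]
    rw [Finset.sum_congr rfl e1, Finset.sum_congr rfl e2, Finset.sum_add_distrib,
      Finset.sum_add_distrib, Finset.Nat.sum_antidiagonal_succ' (n := n)
        (f := fun p => (p.2 : k) • (c p.1 * q p.2)), Finset.Nat.sum_antidiagonal_succ (n := n)
        (f := fun p => (p.1 : k) • (c p.1 * q p.2))]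
    simp

/-- The Euler derivation `t d/dt`. -/
def euler : PowerSeries R →+ PowerSeries R where
  toFun W := PowerSeries.mk fun n => n • PowerSeries.coeff n W
  map_zero' := by ext n; simp
  map_add' V W := by ext n; simp

theorem coeff_euler (W : PowerSeries R) (n : ℕ) :
    PowerSeries.coeff n (euler W) = n • PowerSeries.coeff n W :=
  PowerSeries.coeff_mk n fun n => n • PowerSeries.coeff n W

theorem euler_mul (V W : PowerSeries R) : euler (V * W) = euler V * W + V * euler W := by
  ext n
  rw [coeff_euler, map_add, PowerSeries.coeff_mul, PowerSeries.coeff_mul, PowerSeries.coeff_mul,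
    Finset.smul_sum, ← Finset.sum_add_distrib]
  refine Finset.sum_congr rfl fun p hp => ?_
  rw [coeff_euler, coeff_euler, ← Finset.HasAntidiagonal.mem_antidiagonal.1 hp, add_smul,
    smul_mul_assoc, mul_smul_comm]

theorem euler_mem {W : PowerSeries R} {n : ℕ} (h : W ∈ fil n) : euler W ∈ fil n :=
  fun m hm => by rw [coeff_euler, h m hm, smul_zero]

theorem euler_one : euler (1 : PowerSeries R) = 0 := by
  have := euler_mul (1 : PowerSeries R) 1
  simpa using this

omit [CharZero k] in
theorem euler_smul (c : k) (W : PowerSeries R) : euler (c • W) = c • euler W := by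
  ext n
  rw [coeff_euler, PowerSeries.coeff_smul, PowerSeries.coeff_smul, coeff_euler, smul_comm]

/-- The degree r + 1 part in W of the formula E(e^W) = ((e^{ad W} - 1)/ad W)(E W) · e^W. It holds by
induction: apply the Leibniz rule to W · W^{r+1}, and move the left factor W past the iterated
commutators. -/
theorem euler_divPow (W : PowerSeries R) (r : ℕ) :
    euler (((r + 1).factorial : k)⁻¹ • W ^ (r + 1)) =
    ∑ p ∈ Finset.HasAntidiagonal.antidiagonal r,
      (((p.1 + 1).factorial : k)⁻¹ • iterBracket W (euler W) p.1) *
        ((p.2.factorial : k)⁻¹ • W ^ p.2) := by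
  set q : ℕ → PowerSeries R := fun j => (j.factorial : k)⁻¹ • W ^ j with hq
  set b : ℕ → PowerSeries R := fun i => ((i + 1).factorial : k)⁻¹ • iterBracket W (euler W) i
    with hb
  have hq1 : ∀ j, W * q j = ((j + 1 : ℕ) : k) • q (j + 1) := fun j => by
    have : ((j + 1 : ℕ) : k) ≠ 0 := Nat.cast_ne_zero.2 (by omega)
    simp only [hq]
    rw [mul_smul_comm, ← pow_succ', smul_smul, Nat.factorial_succ, Nat.cast_mul, mul_inv,
      mul_inv_cancel_left₀ this]
  have hb1 : ∀ i, W * b i = b i * W + ((i + 2 : ℕ) : k) • b (i + 1) := fun i => by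
    have : ((i + 2 : ℕ) : k) ≠ 0 := Nat.cast_ne_zero.2 (by omega)
    simp only [hb]
    rw [mul_smul_comm, smul_mul_assoc, smul_smul, Nat.factorial_succ (i + 1), Nat.cast_mul,
      mul_inv, mul_inv_cancel_left₀ this, ← smul_add, iterBracket_succ]
    congr 1
    abel
  change euler (q (r + 1)) = ∑ p ∈ Finset.HasAntidiagonal.antidiagonal r, b p.1 * q p.2
  induction r with
  | zero => simp [hq, hb, iterBracket_zero]
  | succ r ih =>
    have h0 : ((r + 2 : ℕ) : k) ≠ 0 := Nat.cast_ne_zero.2 (by omega)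
    -- Here r + 2 splits as j + (i + 1) with i + j = r + 1; the boundary term i = 0 accounts for
    -- E(W) times the divided power of W.
    refine smul_right_injective _ h0 ?_
    change ((r + 2 : ℕ) : k) • euler (q (r + 1 + 1)) = ((r + 2 : ℕ) : k) • _
    rw [← euler_smul, ← hq1, euler_mul, ih, Finset.mul_sum, Finset.smul_sum]
    have e1 : ∀ p ∈ Finset.HasAntidiagonal.antidiagonal r, W * (b p.1 * q p.2) =
        ((p.2 + 1 : ℕ) : k) • (b p.1 * q (p.2 + 1)) +
          ((p.1 + 1 + 1 : ℕ) : k) • (b (p.1 + 1) * q p.2) := fun p _ => by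
      rw [← mul_assoc, hb1, add_mul, mul_assoc, hq1, mul_smul_comm, smul_mul_assoc _ (b (p.1 + 1))]
    have e2 : ∀ p ∈ Finset.HasAntidiagonal.antidiagonal (r + 1),
        ((r + 2 : ℕ) : k) • (b p.1 * q p.2) =
          (p.2 : k) • (b p.1 * q p.2) + ((p.1 + 1 : ℕ) : k) • (b p.1 * q p.2) := fun p hp => by
      have := Finset.HasAntidiagonal.mem_antidiagonal.1 hp
      rw [← add_smul, ← Nat.cast_add]
      congr 2
      omega
    have hb0 : b 0 = euler W := by simp [hb, iterBracket_zero]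
    rw [Finset.sum_congr rfl e1, Finset.sum_congr rfl e2, Finset.sum_add_distrib,
      Finset.sum_add_distrib, Finset.Nat.sum_antidiagonal_succ' (n := r)
        (f := fun p => (p.2 : k) • (b p.1 * q p.2)), Finset.Nat.sum_antidiagonal_succ (n := r)
        (f := fun p => ((p.1 + 1 : ℕ) : k) • (b p.1 * q p.2))]
    simp [hb0]
    abel

/-- The logarithmic derivative of an exponential. -/
theorem euler_exp {W : PowerSeries R} (hW : W ∈ fil 1) :
    euler (ser (expS k) W) =
      (lsum fun r => (((r + 1).factorial : k)⁻¹ • iterBracket W (euler W) r)) *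
        ser (expS k) W := by
  have h1 : ∀ r, ((r + 1).factorial : k)⁻¹ • iterBracket W (euler W) r ∈ fil r := fun r =>
    FiltrationSMul.smul_mem _
      (fil_le (Nat.le_add_left r 1) (iterBracket_mem hW (euler_mem hW) r))
  unfold ser
  rw [lsum_mul_lsum h1 (ser_term_mem _ hW),
    map_lsum euler (fun n a ha => euler_mem ha) (ser_term_mem _ hW),
    lsum_shift (fun n => euler_mem (ser_term_mem _ hW n))
      (by simp [euler_smul, euler_one])]
  congr 1
  funext r
  simp only [expS, PowerSeries.coeff_mk]
  exact euler_divPow W r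

/-- The contraction principle for the t-adic topology: the iterates of 0 converge, and the limit is
written as their telescoping sum. -/
theorem exists_fixed_powerSeries (Φ : PowerSeries R → PowerSeries R)
    (h : ∀ n W W', W - W' ∈ fil n → Φ W - Φ W' ∈ fil (n + 1)) : ∃ W, Φ W = W := by
  have hc : ∀ n, Φ^[n + 1] 0 - Φ^[n] 0 ∈ fil n := fun n => by
    induction n with
    | zero => exact fun m hm => by omega
    | succ n ih =>
      rw [Function.iterate_succ_apply' Φ (n + 1), Function.iterate_succ_apply' Φ n]
      exact h _ _ _ (by rwa [Function.iterate_succ_apply' Φ n] at ih)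
  refine ⟨lsum fun n => Φ^[n + 1] 0 - Φ^[n] 0, eq_of_sub_mem_fil fun N => ?_⟩
  have h1 : ∀ M, lsum (fun n => Φ^[n + 1] 0 - Φ^[n] 0) - Φ^[M] 0 ∈ fil M := fun M => by
    have := lsum_sub_mem hc M
    rwa [Finset.sum_range_sub (fun n => Φ^[n] 0), Function.iterate_zero, id, sub_zero] at this
  have h2 := h _ _ _ (h1 N)
  rw [← Function.iterate_succ_apply' Φ N] at h2
  have := fil_le (Nat.le_succ N) (sub_mem h2 (h1 (N + 1)))
  simpa using this

omit [CharZero k] in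
/-- Surjectivity of the exponential on power series with constant coefficient one. -/
theorem exists_ser_exp_eq {Z : PowerSeries R} (hZ : PowerSeries.coeff 0 Z = 1) :
    ∃ W : PowerSeries R, W ∈ fil 1 ∧ ser (expS k) W = Z := by
  -- The equation e^W = Z is rewritten as W = Z - 1 - P(W), where P starts in degree 2 and is
  -- therefore contracting. The map τ drops the constant coefficient, so that P(τ W) is controlled
  -- for every W; the fixed point turns out to have no constant coefficient.
  set P : PowerSeries k := expS k - 1 - PowerSeries.X with hP
  set τ : PowerSeries R → PowerSeries R := fun W =>
    W - PowerSeries.C (PowerSeries.coeff 0 W) with hτ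
  have hτ1 : ∀ W, τ W ∈ fil 1 := fun W m hm => by
    obtain rfl : m = 0 := by omega
    simp [hτ]
  have hτ2 : ∀ {W}, W ∈ fil 1 → τ W = W := fun {W} hW => by
    simp only [hτ]
    rw [hW 0 one_pos, map_zero, sub_zero]
  have hτ3 : ∀ {n W W'}, W - W' ∈ fil n → τ W - τ W' ∈ fil n := by
    intro n W W' hW m hm
    have h0 := hW m hm
    rw [map_sub, sub_eq_zero] at h0
    rcases Nat.eq_zero_or_pos m with rfl | hm'
    · exact sub_mem (hτ1 W) (hτ1 W') 0 one_pos
    · simp [hτ, PowerSeries.coeff_C, hm'.ne', h0]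
  have hPs : ∀ a : PowerSeries R, a ∈ fil 1 → ser P a = ser (expS k) a - 1 - a := by
    intro a ha
    have h1 : expS k = P + 1 + PowerSeries.X := by rw [hP]; ring
    rw [h1, ser_add _ _ ha, ser_add _ _ ha, ser_one ha, ser_X ha]
    abel
  obtain ⟨W, hW⟩ := exists_fixed_powerSeries (fun W => Z - 1 - ser P (τ W)) (by
    intro n W W' h
    have : ser P (τ W') - ser P (τ W) ∈ fil (n + 1) := by
      refine lsum_sub_lsum_mem (ser_term_mem _ (hτ1 _)) (ser_term_mem _ (hτ1 _)) fun r => ?_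
      rcases r with _ | _ | r
      · simp [zero_mem]
      · have : PowerSeries.coeff 1 P = 0 := by simp [hP, expS, PowerSeries.coeff_one]
        simp [this, zero_mem]
      · rw [← smul_sub]
        refine FiltrationSMul.smul_mem _ (fil_le (by omega : n + 1 ≤ n + (r + 1))
          (pow_sub_pow_mem (hτ1 _) (hτ1 _) (hτ3 ?_) _))
        simpa using neg_mem h
    simpa using this)
  have hW1 : W ∈ fil 1 := by
    rw [← hW, hPs _ (hτ1 _)]
    have h3 : ser (expS k) (τ W) - 1 ∈ fil 1 := by
      have := lsum_sub_mem (ser_term_mem (expS k) (hτ1 W)) 1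
      simpa [ser, expS] using this
    have h4 : Z - 1 ∈ fil 1 := fun m hm => by
      obtain rfl : m = 0 := by omega
      simpa [sub_eq_zero] using hZ
    exact sub_mem h4 (sub_mem h3 (hτ1 W))
  refine ⟨W, hW1, ?_⟩
  simp only [hτ2 hW1, hPs _ hW1] at hW
  have : ser (expS k) W = Z - (Z - 1 - (ser (expS k) W - 1 - W)) + W := by abel
  rw [this, hW]
  abel

/-- With Z starting at 1, the lowest coefficient of P reappears unchanged in the product. This
allows the exponential to be cancelled in an equality of logarithmic derivatives. -/
theorem eq_zero_of_mul_eq_zero {P Z : PowerSeries R} (hZ : PowerSeries.coeff 0 Z = 1)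
    (h : P * Z = 0) : P = 0 := by
  ext n
  induction n using Nat.strong_induction_on with
  | _ n ih =>
    have := congrArg (PowerSeries.coeff n) h
    rw [PowerSeries.coeff_mul, Finset.sum_eq_single (n, 0)] at this
    · simpa [-PowerSeries.coeff_zero_eq_constantCoeff, hZ] using this
    · intro p hp hne
      have h1 := Finset.HasAntidiagonal.mem_antidiagonal.1 hp
      have : p.1 < n := by
        rcases p with ⟨i, j⟩
        simp only [ne_eq, Prod.mk.injEq, not_and] at hne h1 ⊢
        omega
      rw [ih _ this, map_zero, zero_mul]
    · simp

/-- The series `exp(t u)`. -/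
def expT (k : Type*) [Field k] {R : Type*} [Ring R] [Algebra k R] (u : R) : PowerSeries R :=
  PowerSeries.mk fun n => (n.factorial : k)⁻¹ • u ^ n

/-- This is e^{tu} v = (e^{t ad u} v) e^{tu}, read off coefficientwise from `divPow_mul`. -/
theorem expT_mul_C (u v : R) : expT k u * PowerSeries.C v =
    (PowerSeries.mk fun i => (i.factorial : k)⁻¹ • iterBracket u v i) * expT k u := by
  ext n
  rw [PowerSeries.coeff_mul_C, PowerSeries.coeff_mul]
  simp only [expT, PowerSeries.coeff_mk]
  exact divPow_mul u v n

theorem euler_expT (u : R) :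
    euler (expT k u) = PowerSeries.X * (PowerSeries.C u * expT k u) := by
  ext n
  rw [coeff_euler]
  cases n with
  | zero => simp
  | succ n =>
    have : ((n + 1 : ℕ) : k) ≠ 0 := Nat.cast_ne_zero.2 (by omega)
    rw [PowerSeries.coeff_succ_X_mul, PowerSeries.coeff_C_mul]
    simp only [expT, PowerSeries.coeff_mk]
    rw [← Nat.cast_smul_eq_nsmul k, mul_smul_comm, ← pow_succ', smul_smul, Nat.factorial_succ,
      Nat.cast_mul, mul_inv, mul_inv_cancel_left₀ this]

variable (k) in
/-- The logarithmic derivative of `exp(t u) exp(t v)`. -/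
theorem euler_expT_mul (u v : R) : euler (expT k u * expT k v) =
    PowerSeries.X * (PowerSeries.C u +
      PowerSeries.mk fun i => (i.factorial : k)⁻¹ • iterBracket u v i) *
        (expT k u * expT k v) := by
  rw [euler_mul, euler_expT, euler_expT]
  have h1 : expT k u * (PowerSeries.X * (PowerSeries.C v * expT k v)) =
      PowerSeries.X * (expT k u * PowerSeries.C v) * expT k v := by
    rw [← mul_assoc, (PowerSeries.commute_X (expT k u)).eq]
    simp only [mul_assoc]
  rw [h1, expT_mul_C]
  simp only [mul_add, add_mul, mul_assoc]

/-- The Baker–Campbell–Hausdorff theorem, for formal one-parameter families: the logarithm of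
`exp(t u) exp(t v)` has coefficients in the graded Lie algebra generated by `u` and `v`. -/
theorem exists_exp_eq_expT_mul (L : ℕ → Submodule k R)
    (hL : ∀ {m n : ℕ} {a b : R}, a ∈ L m → b ∈ L n → a * b - b * a ∈ L (m + n)) {u v : R}
    (hu : u ∈ L 1) (hv : v ∈ L 1) :
    ∃ W : PowerSeries R, W ∈ fil 1 ∧ (∀ n, PowerSeries.coeff n W ∈ L n) ∧
      ser (expS k) W = expT k u * expT k v := by
  have hZ : PowerSeries.coeff 0 (expT k u * expT k v) = 1 := by
    rw [PowerSeries.coeff_mul]; simp [expT]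
  obtain ⟨W, hW, hWZ⟩ := exists_ser_exp_eq (k := k) hZ
  refine ⟨W, hW, ?_, hWZ⟩
  set κ : PowerSeries R := PowerSeries.X * (PowerSeries.C u +
      PowerSeries.mk fun i => (i.factorial : k)⁻¹ • iterBracket u v i) with hκ
  -- Both sides are the logarithmic derivative of e^W = e^{tu} e^{tv}. The left one is a series of
  -- commutators in W, the right one visibly has Lie coefficients.
  have hKκ : (lsum fun r => (((r + 1).factorial : k)⁻¹ • iterBracket W (euler W) r)) = κ := by
    refine sub_eq_zero.1 (eq_zero_of_mul_eq_zero hZ ?_)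
    rw [sub_mul, sub_eq_zero, ← hWZ, ← euler_exp hW, hWZ]
    exact euler_expT_mul k u v
  have hc : ∀ i, iterBracket u v i ∈ L (i + 1) := fun i => by
    induction i with
    | zero => exact hv
    | succ i ih =>
      rw [iterBracket_succ, add_comm]
      exact hL hu ih
  have hκL : ∀ n, 0 < n → PowerSeries.coeff n κ ∈ L n := by
    intro n hn
    obtain ⟨m, rfl⟩ : ∃ m, n = m + 1 := ⟨n - 1, by omega⟩
    rw [hκ, PowerSeries.coeff_succ_X_mul, map_add, PowerSeries.coeff_mk, PowerSeries.coeff_C]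
    refine add_mem ?_ (Submodule.smul_mem _ _ (hc m))
    split_ifs with h
    · subst h; exact hu
    · exact zero_mem _
  intro n
  induction n using Nat.strong_induction_on with
  | _ n ih =>
    rcases Nat.eq_zero_or_pos n with rfl | hn
    · rw [hW 0 one_pos]; exact zero_mem _
    have hb0 : ∀ s, PowerSeries.coeff 0 (iterBracket W (euler W) s) = 0 := fun s =>
      fil_le (Nat.le_add_right 1 s) (iterBracket_mem hW (euler_mem hW) s) 0 one_pos
    have hstep : ∀ m s, PowerSeries.coeff m (iterBracket W (euler W) (s + 1)) =
        ∑ p ∈ Finset.HasAntidiagonal.antidiagonal m,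
          (PowerSeries.coeff p.1 W * PowerSeries.coeff p.2 (iterBracket W (euler W) s) -
            PowerSeries.coeff p.2 (iterBracket W (euler W) s) * PowerSeries.coeff p.1 W) := by
      intro m s
      rw [iterBracket_succ, map_sub, PowerSeries.coeff_mul, PowerSeries.coeff_mul,
        Finset.sum_sub_distrib]
      congr 1
      exact (Finset.Nat.sum_antidiagonal_swap (n := m) (f := fun p =>
        PowerSeries.coeff p.1 (iterBracket W (euler W) s) * PowerSeries.coeff p.2 W)).symm
    have hb1 : ∀ s, ∀ m < n, PowerSeries.coeff m (iterBracket W (euler W) s) ∈ L m := by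
      intro s
      induction s with
      | zero =>
        intro m hm
        rw [iterBracket_zero, coeff_euler]
        exact nsmul_mem (ih m hm) m
      | succ s ihs =>
        intro m hm
        rw [hstep]
        refine sum_mem fun p hp => ?_
        have := Finset.HasAntidiagonal.mem_antidiagonal.1 hp
        exact this ▸ hL (ih _ (by omega)) (ihs _ (by omega))
    -- Neither W nor its iterated commutators have a constant coefficient, so a genuine commutator
    -- in degree n involves only degrees below n, where the induction hypothesis applies.
    have hb2 : ∀ s, PowerSeries.coeff n (iterBracket W (euler W) (s + 1)) ∈ L n := by
      intro s
      rw [hstep]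
      refine sum_mem fun p hp => ?_
      have := Finset.HasAntidiagonal.mem_antidiagonal.1 hp
      by_cases h1 : p.1 = 0
      · rw [h1, hW 0 one_pos]; simp
      by_cases h2 : p.2 = 0
      · rw [h2, hb0]; simp
      exact this ▸ hL (ih _ (by omega)) (hb1 s _ (by omega))
    -- In degree n the identity reads n W_n + (commutators of lower coefficients) = κ_n; dividing by
    -- n uses characteristic zero.
    have hK := congrArg (PowerSeries.coeff n) hKκ
    rw [coeff_lsum, Finset.sum_range_succ', iterBracket_zero] at hK
    simp only [PowerSeries.coeff_smul, zero_add, Nat.factorial_one, Nat.cast_one, inv_one,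
      one_smul, coeff_euler] at hK
    have h0 : (n : k) ≠ 0 := Nat.cast_ne_zero.2 (by omega)
    rw [← Submodule.smul_mem_iff _ h0, Nat.cast_smul_eq_nsmul, eq_sub_of_add_eq' hK]
    exact sub_mem (hκL n hn) (sum_mem fun s _ => Submodule.smul_mem _ _ (hb2 s))

end Formal

/-! ### Specialization at t = 1 -/

section EvalOne

variable {k A : Type*} [Field k] [Ring A] [Algebra k A] [CompleteFiltration A]

/-- The value at `t = 1` of a power series whose `r`-th coefficient lies in the `r`-th step of the
filtration. -/
def evalOne (P : PowerSeries A) : A := lsum fun r => PowerSeries.coeff r P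

/-- Power series whose `r`-th coefficient lies in the `r`-th step of the filtration. -/
def IsGraded (P : PowerSeries A) : Prop := ∀ r, PowerSeries.coeff r P ∈ fil r

theorem IsGraded.mul {P Q : PowerSeries A} (hP : IsGraded P) (hQ : IsGraded Q) :
    IsGraded (P * Q) := fun r => by
  rw [PowerSeries.coeff_mul]
  exact antidiagonal_mem hP hQ r

theorem IsGraded.one : IsGraded (1 : PowerSeries A) := fun r => by
  rw [PowerSeries.coeff_one]
  split_ifs with h
  · subst h; exact CompleteFiltration.one_mem
  · exact zero_mem _

theorem IsGraded.pow {P : PowerSeries A} (hP : IsGraded P) (r : ℕ) : IsGraded (P ^ r) := by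
  induction r with
  | zero => simpa using IsGraded.one
  | succ r ih => rw [pow_succ]; exact ih.mul hP

theorem IsGraded.smul [FiltrationSMul k A] (c : k) {P : PowerSeries A} (hP : IsGraded P) :
    IsGraded (c • P) := fun r => by
  rw [PowerSeries.coeff_smul]
  exact FiltrationSMul.smul_mem c (hP r)

theorem evalOne_mul {P Q : PowerSeries A} (hP : IsGraded P) (hQ : IsGraded Q) :
    evalOne (P * Q) = evalOne P * evalOne Q := by
  unfold evalOne
  rw [lsum_mul_lsum hP hQ]
  simp only [PowerSeries.coeff_mul]

theorem evalOne_one : evalOne (1 : PowerSeries A) = 1 := by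
  unfold evalOne
  rw [lsum_single (m := 0) IsGraded.one (fun r hr => by rw [PowerSeries.coeff_one, if_neg hr])]
  simp

theorem evalOne_pow {P : PowerSeries A} (hP : IsGraded P) (r : ℕ) :
    evalOne (P ^ r) = evalOne P ^ r := by
  induction r with
  | zero => simpa using evalOne_one
  | succ r ih => rw [pow_succ, pow_succ, evalOne_mul (hP.pow r) hP, ih]

theorem lsum_smul [FiltrationSMul k A] (c : k) {a : ℕ → A} (ha : ∀ n, a n ∈ fil n) :
    lsum (fun r => c • a r) = c • lsum a :=
  (map_lsum (DistribSMul.toAddMonoidHom A c) (fun _ _ h => FiltrationSMul.smul_mem c h) ha).symm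

theorem evalOne_smul [FiltrationSMul k A] (c : k) {P : PowerSeries A} (hP : IsGraded P) :
    evalOne (c • P) = c • evalOne P := by
  unfold evalOne
  rw [← lsum_smul c hP]
  simp only [PowerSeries.coeff_smul]

theorem evalOne_mem {P : PowerSeries A} (hP : IsGraded P) {N : ℕ} (h : P ∈ fil N) :
    evalOne P ∈ fil N := lsum_mem hP h

/-- Interchange of two infinite sums: modulo step N both orders reduce to the same N by N sum of
coefficients. -/
theorem evalOne_lsum {a : ℕ → PowerSeries A} (ha : ∀ r, a r ∈ fil r) (hg : ∀ r, IsGraded (a r)) :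
    evalOne (lsum a) = lsum fun r => evalOne (a r) := by
  have hl : IsGraded (lsum a) := fun r => by
    rw [coeff_lsum]; exact sum_mem fun s _ => hg s r
  refine eq_lsum (fun r => evalOne_mem (hg r) (ha r)) fun N => ?_
  have h1 := lsum_sub_mem hl N
  have h2 := sum_mem fun r (_ : r ∈ Finset.range N) => lsum_sub_mem (hg r) N
  have h3 : ∑ m ∈ Finset.range N, PowerSeries.coeff m (lsum a) =
      ∑ r ∈ Finset.range N, ∑ m ∈ Finset.range N, PowerSeries.coeff m (a r) := by
    rw [Finset.sum_comm]
    refine Finset.sum_congr rfl fun m hm => ?_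
    rw [coeff_lsum]
    refine Finset.sum_subset (Finset.range_subset_range.2 (by simpa using hm)) fun r _ hr => ?_
    exact ha r m (by simp at hr; omega)
  have := sub_mem h1 h2
  rw [Finset.sum_sub_distrib, h3] at this
  convert this using 1
  unfold evalOne
  abel

/-- Transfers identities between formal exponentials to A. The condition `P ∈ fil 1` gives
convergence in t, and gradedness gives convergence in A once t = 1. -/
theorem evalOne_ser [FiltrationSMul k A] (Q : PowerSeries k) {P : PowerSeries A}
    (hP : IsGraded P) (h : P ∈ fil 1) : evalOne (ser Q P) = ser Q (evalOne P) := by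
  unfold ser
  rw [evalOne_lsum (ser_term_mem Q h) fun r => (hP.pow r).smul _]
  simp only [evalOne_smul _ (hP.pow _), evalOne_pow hP]

theorem IsGraded.expT [FiltrationSMul k A] {a : A} (ha : a ∈ fil 1) : IsGraded (expT k a) :=
  fun r => by
    simp only [KashiwaraVergne.expT, PowerSeries.coeff_mk]
    exact FiltrationSMul.smul_mem _ (pow_mem_fil ha r)

theorem evalOne_expT (a : A) : evalOne (expT k a) = ser (expS k) a := by
  simp only [evalOne, ser, expT, expS, PowerSeries.coeff_mk]

end EvalOne

/-! ### The completed free Lie algebra -/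

section Lie

variable {k : Type*} [Field k] {n : ℕ}

/-- The homogeneous component, as a linear map. -/
def homogHom (d : ℕ) : Ass k n →ₗ[k] Ass k n where
  toFun := homog d
  map_add' f g := by ext w; by_cases h : w.length = d <;> simp [homog, h]
  map_smul' c f := by ext w; by_cases h : w.length = d <;> simp [homog, h]

theorem homogHom_apply (d : ℕ) (f : Ass k n) : homogHom d f = homog d f := rfl

theorem homog_eq_zero {d N : ℕ} {f : Ass k n} (hf : f ∈ fil N) (h : d < N) : homog d f = 0 := by
  ext w
  simp only [homog, Ass.zero_apply, ite_eq_right_iff]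
  intro hw
  exact hf w (by omega)

theorem homog_congr {d N : ℕ} {f g : Ass k n} (hf : f - g ∈ fil N) (h : d < N) :
    homog d f = homog d g := by
  have := homog_eq_zero hf h
  rwa [← homogHom_apply, map_sub, sub_eq_zero] at this

theorem sub_sum_homog_mem (f : Ass k n) (N : ℕ) :
    f - ∑ d ∈ Finset.range N, homog d f ∈ fil N := by
  intro w hw
  rw [Ass.sub_apply, Ass.sum_apply, Finset.sum_eq_single w.length]
  · simp [homog]
  · intro d _ hd; simp [homog, hd.symm]
  · intro h; exact absurd (Finset.mem_range.2 hw) h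

theorem homog_mul (f g : Ass k n) (d : ℕ) : homog d (f * g) =
    ∑ p ∈ Finset.HasAntidiagonal.antidiagonal d, homog p.1 f * homog p.2 g := by
  ext w
  rw [Ass.sum_apply]
  by_cases h : w.length = d
  · rw [Finset.Nat.sum_antidiagonal_eq_sum_range_succ (fun p q => (homog p f * homog q g) w)]
    simp only [homog, h, if_true]
    rw [Ass.mul_apply, h]
    refine Finset.sum_congr rfl fun i hi => ?_
    rw [Ass.mul_apply, Finset.sum_eq_single i]
    · simp only [Finset.mem_range] at hi
      simp only [List.length_take, List.length_drop]
      rw [if_pos (by omega), if_pos (by omega)]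
    · intro j hj hji
      simp only [Finset.mem_range] at hj
      simp only [List.length_take]
      rw [if_neg (by omega), zero_mul]
    · intro h'; exact absurd (h ▸ hi) h'
  · rw [Finset.sum_eq_zero]
    · simp [homog, h]
    · intro p hp
      have := Finset.HasAntidiagonal.mem_antidiagonal.1 hp
      rw [Ass.mul_apply]
      refine Finset.sum_eq_zero fun i hi => ?_
      simp only [Finset.mem_range] at hi
      simp only [homog, List.length_take, List.length_drop]
      split_ifs <;> first | omega | simp

theorem lie_add_mem {f g : Ass k n} (hf : f ∈ lie k n) (hg : g ∈ lie k n) : f + g ∈ lie k n := by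
  intro d
  rw [← homogHom_apply, map_add]
  exact add_mem (hf d) (hg d)

theorem lie_smul_mem (c : k) {f : Ass k n} (hf : f ∈ lie k n) : c • f ∈ lie k n := by
  intro d
  rw [← homogHom_apply, map_smul]
  exact (LieSubalgebra.lieSpan k (Ass k n) (Set.range X)).smul_mem c (hf d)

theorem lie_zero_mem : (0 : Ass k n) ∈ lie k n := by
  intro d
  rw [← homogHom_apply, map_zero]
  exact zero_mem _

theorem lie_neg_mem {f : Ass k n} (hf : f ∈ lie k n) : -f ∈ lie k n := by
  have := lie_smul_mem (-1) hf
  rwa [neg_one_smul] at this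

theorem lie_bracket_mem {f g : Ass k n} (hf : f ∈ lie k n) (hg : g ∈ lie k n) :
    f * g - g * f ∈ lie k n := by
  intro d
  rw [← homogHom_apply, map_sub, homogHom_apply, homogHom_apply, homog_mul, homog_mul,
    ← Finset.Nat.sum_antidiagonal_swap (f := fun p => homog p.1 g * homog p.2 f),
    ← Finset.sum_sub_distrib]
  refine sum_mem fun p _ => ?_
  rw [Prod.fst_swap, Prod.snd_swap, ← LieRing.of_associative_ring_bracket]
  exact LieSubalgebra.lie_mem _ (hf p.1) (hg p.2)

theorem X_mem_fil (i : Fin n) : (X i : Ass k n) ∈ fil 1 := Ass.mem_fil_one.2 (X_nil i)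

theorem X_mem_lie (i : Fin n) : (X i : Ass k n) ∈ lie k n := by
  intro d
  by_cases h : d = 1
  · have : homog d (X i : Ass k n) = X i := by
      ext w
      simp only [homog, X, h]
      by_cases hw : w = [i]
      · simp [hw]
      · simp [hw]
    rw [this]
    exact LieSubalgebra.subset_lieSpan ⟨i, rfl⟩
  · have : homog d (X i : Ass k n) = 0 := by
      ext w
      simp only [homog, X, Ass.zero_apply]
      split_ifs with h1 h2
      · subst h2; simp at h1; omega
      · rfl
      · rfl
    rw [this]
    exact zero_mem _

variable (k n) in
/-- The completed free Lie algebra, as a Lie subalgebra of `Ass_n`. -/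
def lieSubalgebra : LieSubalgebra k (Ass k n) where
  carrier := lie k n
  add_mem' := lie_add_mem
  zero_mem' := lie_zero_mem
  smul_mem' c _ := lie_smul_mem c
  lie_mem' hf hg := lie_bracket_mem hf hg

/-- In degree d only the terms r ≤ d contribute, so membership is tested on a finite sum. -/
theorem lsum_mem_lie {f : ℕ → Ass k n} (hf : ∀ r, f r ∈ fil r) (hl : ∀ r, f r ∈ lie k n) :
    lsum f ∈ lie k n := by
  intro d
  rw [homog_congr (lsum_sub_mem hf (d + 1)) (Nat.lt_succ_self d)]
  have : ∑ r ∈ Finset.range (d + 1), f r ∈ lieSubalgebra k n := sum_mem fun r _ => hl r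
  exact this d

end Lie

/-! ### The filtered Lie algebra of tangential derivations -/

namespace TDer

variable {k : Type*} [Field k] {n : ℕ}

theorem toEnd_mem_fil (u : TDer k n) : u.toEnd ∈ fil 1 := fun p f hf w hw =>
  u.toEnd_apply_eq_zero f p hf w hw

theorem comp_mem_fil (u : TDer k n) (i : Fin n) : u.comp i ∈ fil 1 :=
  Ass.mem_fil_one.2 (u.comp_nil i)

theorem toEnd_bracket (u : TDer k n) (f g : Ass k n) : u.toEnd (f * g - g * f) =
    (u.toEnd f * g - g * u.toEnd f) + (f * u.toEnd g - u.toEnd g * f) := by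
  rw [map_sub, u.leibniz, u.leibniz]
  abel

/-- By the Leibniz rule the elements of `lie` that u maps into `lie` form a Lie subalgebra, which
contains the letters. For a series, the degree d part of the image depends only on a truncation,
because u raises the degree. -/
theorem toEnd_mem_lie (u : TDer k n) {f : Ass k n} (hf : f ∈ lie k n) :
    u.toEnd f ∈ lie k n := by
  have key : LieSubalgebra.lieSpan k (Ass k n) (Set.range X) ≤
      { carrier := {f : Ass k n | f ∈ lie k n ∧ u.toEnd f ∈ lie k n}
        add_mem' := fun {a b} ha hb => ⟨lie_add_mem ha.1 hb.1, by
          rw [map_add]; exact lie_add_mem ha.2 hb.2⟩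
        zero_mem' := ⟨lie_zero_mem, by rw [map_zero]; exact lie_zero_mem⟩
        smul_mem' := fun c f hf => ⟨lie_smul_mem c hf.1, by
          rw [map_smul]; exact lie_smul_mem c hf.2⟩
        lie_mem' := fun {a b} ha hb => ⟨lie_bracket_mem ha.1 hb.1, by
          rw [LieRing.of_associative_ring_bracket, toEnd_bracket]
          exact lie_add_mem (lie_bracket_mem ha.2 hb.1) (lie_bracket_mem ha.1 hb.2)⟩ } := by
    rw [LieSubalgebra.lieSpan_le]
    rintro _ ⟨i, rfl⟩
    refine ⟨X_mem_lie i, ?_⟩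
    rw [u.map_X]
    exact lie_bracket_mem (X_mem_lie i) (u.comp_mem i)
  intro d
  have h1 := u.toEnd_mem_fil _ _ (sub_sum_homog_mem f (d + 1))
  rw [map_sub] at h1
  rw [homog_congr h1 (by omega)]
  have h2 : ∑ e ∈ Finset.range (d + 1), homog e f ∈
      LieSubalgebra.lieSpan k (Ass k n) (Set.range X) := sum_mem fun e _ => hf e
  exact (key h2).2 d

/-- `u` raises the degree by at least `m`. -/
def HasOrder (u : TDer k n) (m : ℕ) : Prop := u.toEnd ∈ fil m ∧ ∀ i, u.comp i ∈ fil m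

theorem hasOrder_one (u : TDer k n) : u.HasOrder 1 := ⟨u.toEnd_mem_fil, u.comp_mem_fil⟩

instance : Zero (TDer k n) where
  zero :=
    { toEnd := 0
      comp := 0
      leibniz := fun f g => by simp
      comp_mem := fun i => lie_zero_mem
      normalized := fun i => rfl
      map_X := fun i => by simp }

instance : Add (TDer k n) where
  add u v :=
    { toEnd := u.toEnd + v.toEnd
      comp := u.comp + v.comp
      leibniz := fun f g => by
        simp only [LinearMap.add_apply, u.leibniz, v.leibniz, add_mul, mul_add]; abel
      comp_mem := fun i => lie_add_mem (u.comp_mem i) (v.comp_mem i)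
      normalized := fun i => by simp [u.normalized, v.normalized]
      map_X := fun i => by
        simp only [LinearMap.add_apply, u.map_X, v.map_X, Pi.add_apply, add_mul, mul_add]; abel }

instance : SMul k (TDer k n) where
  smul c u :=
    { toEnd := c • u.toEnd
      comp := c • u.comp
      leibniz := fun f g => by
        simp only [LinearMap.smul_apply, u.leibniz, smul_add, smul_mul_assoc, mul_smul_comm]
      comp_mem := fun i => lie_smul_mem c (u.comp_mem i)
      normalized := fun i => by simp [u.normalized]
      map_X := fun i => by
        simp only [LinearMap.smul_apply, u.map_X, Pi.smul_apply, smul_sub, smul_mul_assoc,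
          mul_smul_comm] }

/-- The commutator of two tangential derivations. -/
instance : Bracket (TDer k n) (TDer k n) where
  bracket u v :=
    { toEnd := u.toEnd * v.toEnd - v.toEnd * u.toEnd
      comp := fun i => u.toEnd (v.comp i) - v.toEnd (u.comp i) +
        (u.comp i * v.comp i - v.comp i * u.comp i)
      leibniz := fun f g => by
        simp only [LinearMap.sub_apply, Module.End.mul_apply, u.leibniz, v.leibniz, map_add]
        noncomm_ring
      comp_mem := fun i => lie_add_mem
        (by
          rw [sub_eq_add_neg]
          exact lie_add_mem (u.toEnd_mem_lie (v.comp_mem i))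
            (lie_neg_mem (v.toEnd_mem_lie (u.comp_mem i))))
        (lie_bracket_mem (u.comp_mem i) (v.comp_mem i))
      -- The components of the bracket start in degree two, so no renormalization is needed.
      normalized := fun i => by
        have h1 : u.toEnd (v.comp i) - v.toEnd (u.comp i) +
            (u.comp i * v.comp i - v.comp i * u.comp i) ∈ fil 2 :=
          add_mem (sub_mem (u.toEnd_mem_fil _ _ (v.comp_mem_fil i))
            (v.toEnd_mem_fil _ _ (u.comp_mem_fil i)))
            (sub_mem (CompleteFiltration.mul_mem (u.comp_mem_fil i) (v.comp_mem_fil i))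
              (CompleteFiltration.mul_mem (v.comp_mem_fil i) (u.comp_mem_fil i)))
        exact h1 [i] (by simp)
      map_X := fun i => by
        simp only [LinearMap.sub_apply, Module.End.mul_apply, u.map_X, v.map_X, map_sub,
          u.leibniz, v.leibniz]
        noncomm_ring }

theorem zero_toEnd : (0 : TDer k n).toEnd = 0 := rfl
theorem zero_comp (i : Fin n) : (0 : TDer k n).comp i = 0 := rfl
theorem add_toEnd (u v : TDer k n) : (u + v).toEnd = u.toEnd + v.toEnd := rfl
theorem add_comp (u v : TDer k n) (i : Fin n) : (u + v).comp i = u.comp i + v.comp i := rfl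
theorem smul_toEnd (c : k) (u : TDer k n) : (c • u).toEnd = c • u.toEnd := rfl
theorem smul_comp (c : k) (u : TDer k n) (i : Fin n) : (c • u).comp i = c • u.comp i := rfl
theorem bracket_toEnd (u v : TDer k n) : ⁅u, v⁆.toEnd = u.toEnd * v.toEnd - v.toEnd * u.toEnd :=
  rfl
theorem bracket_comp (u v : TDer k n) (i : Fin n) : ⁅u, v⁆.comp i =
    u.toEnd (v.comp i) - v.toEnd (u.comp i) + (u.comp i * v.comp i - v.comp i * u.comp i) := rfl

theorem hasOrder_zero (m : ℕ) : (0 : TDer k n).HasOrder m := ⟨zero_mem _, fun _ => zero_mem _⟩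

theorem HasOrder.add {u v : TDer k n} {m : ℕ} (hu : u.HasOrder m) (hv : v.HasOrder m) :
    (u + v).HasOrder m := ⟨add_mem hu.1 hv.1, fun i => add_mem (hu.2 i) (hv.2 i)⟩

theorem HasOrder.smul (c : k) {u : TDer k n} {m : ℕ} (hu : u.HasOrder m) : (c • u).HasOrder m :=
  ⟨FiltrationSMul.smul_mem c hu.1, fun i => FiltrationSMul.smul_mem c (hu.2 i)⟩

/-- Orders add, so the degree r term of the BCH series has order r and the series can be summed by
`sum`. -/
theorem HasOrder.bracket {u v : TDer k n} {p q : ℕ} (hu : u.HasOrder p) (hv : v.HasOrder q) :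
    (⁅u, v⁆).HasOrder (p + q) := by
  have c1 : ∀ {a : Ass k n}, a ∈ fil (q + p) → a ∈ fil (p + q) := fun h => add_comm q p ▸ h
  refine ⟨sub_mem (CompleteFiltration.mul_mem hu.1 hv.1) ?_, fun i => ?_⟩
  · have := CompleteFiltration.mul_mem hv.1 hu.1
    rwa [add_comm] at this
  · exact add_mem (sub_mem (c1 (hu.1 _ _ (hv.2 i))) (hv.1 _ _ (hu.2 i)))
      (sub_mem (CompleteFiltration.mul_mem (hu.2 i) (hv.2 i))
        (c1 (CompleteFiltration.mul_mem (hv.2 i) (hu.2 i))))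

theorem lsum_mul_right {f : ℕ → Ass k n} (hf : ∀ r, f r ∈ fil r) (g : Ass k n) :
    lsum f * g = lsum fun r => f r * g :=
  map_lsum (AddMonoidHom.mulRight g) (fun r a ha => by
    simpa using CompleteFiltration.mul_mem ha (Ass.mem_fil_zero g)) hf

theorem mul_lsum_left {f : ℕ → Ass k n} (hf : ∀ r, f r ∈ fil r) (g : Ass k n) :
    g * lsum f = lsum fun r => g * f r :=
  map_lsum (AddMonoidHom.mulLeft g) (fun r a ha => by
    simpa using CompleteFiltration.mul_mem (Ass.mem_fil_zero g) ha) hf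

/-- The sum of a series of tangential derivations of increasing orders. -/
def sum (w : ℕ → TDer k n) (hw : ∀ r, (w r).HasOrder r) : TDer k n where
  toEnd := lsum fun r => (w r).toEnd
  comp i := lsum fun r => (w r).comp i
  leibniz f g := by
    have h : ∀ f r, (w r).toEnd f ∈ fil r := fun f r => End.apply_mem (hw r).1 f
    have h1 : ∀ r, (w r).toEnd f * g ∈ fil r := fun r => by
      simpa using CompleteFiltration.mul_mem (h f r) (Ass.mem_fil_zero g)
    have h2 : ∀ r, f * (w r).toEnd g ∈ fil r := fun r => by
      simpa using CompleteFiltration.mul_mem (Ass.mem_fil_zero f) (h g r)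
    simp only [End.lsum_apply, (w _).leibniz]
    rw [lsum_add h1 h2, lsum_mul_right (h f), mul_lsum_left (h g)]
  comp_mem i := lsum_mem_lie (fun r => (hw r).2 i) fun r => (w r).comp_mem i
  normalized i := by
    rw [Ass.lsum_apply]
    exact Finset.sum_eq_zero fun r _ => (w r).normalized i
  map_X i := by
    simp only [End.lsum_apply, (w _).map_X]
    exact (map_lsum (AddMonoidHom.mulLeft (X i) - AddMonoidHom.mulRight (X i))
      (fun r a ha => sub_mem
        (by simpa using CompleteFiltration.mul_mem (Ass.mem_fil_zero (X i)) ha)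
        (by simpa using CompleteFiltration.mul_mem ha (Ass.mem_fil_zero (X i))))
      (fun r => (hw r).2 i)).symm

/-- `f ↦ x_i (∂_i f)`, as an additive map. -/
def mulPartial (i : Fin n) : Ass k n →ₗ[k] Ass k n where
  toFun f := X i * partialR i f
  map_add' f g := by rw [← mul_add]; rfl
  map_smul' c f := by rw [RingHom.id_apply, ← mul_smul_comm]; rfl

/-- ∂_i loses one degree and multiplication by x_i restores it; at N = 0 the truncated subtraction
only weakens the bound. -/
theorem mulPartial_mem (i : Fin n) (N : ℕ) {f : Ass k n} (hf : f ∈ fil N) :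
    mulPartial i f ∈ fil N := by
  have h : partialR i f ∈ fil (N - 1) := fun w hw => hf _ (by simp; omega)
  exact fil_le (by omega) (CompleteFiltration.mul_mem (X_mem_fil i) h)

theorem divRep_eq (u : TDer k n) : u.divRep = ∑ i, mulPartial i (u.comp i) := rfl

theorem divRep_mem {u : TDer k n} {m : ℕ} (hu : u.HasOrder m) : u.divRep ∈ fil m :=
  sum_mem fun i _ => mulPartial_mem i m (hu.2 i)

theorem divRep_add (u v : TDer k n) : (u + v).divRep = u.divRep + v.divRep := by
  simp only [divRep_eq, add_comp, map_add, Finset.sum_add_distrib]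

theorem divRep_smul (c : k) (u : TDer k n) : (c • u).divRep = c • u.divRep := by
  simp only [divRep_eq, smul_comp, map_smul, Finset.smul_sum]

theorem divRep_sum (w : ℕ → TDer k n) (hw : ∀ r, (w r).HasOrder r) :
    (sum w hw).divRep = lsum fun r => (w r).divRep := by
  have h : ∀ i, mulPartial i ((sum w hw).comp i) = lsum fun r => mulPartial i ((w r).comp i) :=
    fun i => map_lsum (mulPartial i).toAddMonoidHom (fun N a ha => mulPartial_mem i N ha)
      fun r => (hw r).2 i
  simp only [divRep_eq, h]
  ext w
  simp only [Ass.sum_apply, Ass.lsum_apply]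
  exact Finset.sum_comm

end TDer

/-! ### Cyclic words and the calculus of the operators ∂_i -/

section Trace

variable {k : Type*} [Field k] {n : ℕ}

/-- Summation over the cyclic rotations of a word. -/
def cyc : Ass k n →ₗ[k] Ass k n where
  toFun f := ⟨fun w => ∑ i ∈ Finset.range w.length, f (w.rotate i)⟩
  map_add' f g := by ext w; simp [Finset.sum_add_distrib]
  map_smul' c f := by ext w; simp [Finset.mul_sum]

theorem cyc_apply (f : Ass k n) (w : List (Fin n)) :
    cyc f w = ∑ i ∈ Finset.range w.length, f (w.rotate i) := rfl

theorem sum_rotate_add {M : Type*} [AddCommMonoid M] {α : Type*} (H : List α → M) (w : List α)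
    (j : ℕ) : ∑ i ∈ Finset.range w.length, H (w.rotate (i + j)) =
      ∑ i ∈ Finset.range w.length, H (w.rotate i) := by
  induction j with
  | zero => rfl
  | succ j ih =>
    rw [← ih]
    rcases Nat.eq_zero_or_pos w.length with h | h
    · simp [h]
    obtain ⟨d, hd⟩ : ∃ d, w.length = d + 1 := ⟨w.length - 1, by omega⟩
    rw [hd, Finset.sum_range_succ, Finset.sum_range_succ']
    congr 1
    · exact Finset.sum_congr rfl fun i _ => by rw [add_assoc, add_comm 1 j]
    · rw [show d + (j + 1) = (d + 1) + j by omega, ← hd, ← List.rotate_rotate, List.rotate_length,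
        zero_add]

/-- A rotation turns a factorization w = uv into vu, and the sum over all rotations forgets the
starting point. -/
theorem cyc_mul_comm (a b : Ass k n) : cyc (a * b) = cyc (b * a) := by
  ext w
  simp only [cyc_apply, Ass.mul_apply, List.length_rotate]
  rw [Finset.sum_comm, Finset.sum_comm (s := Finset.range w.length),
    ← Finset.sum_range_reflect _ (w.length + 1)]
  refine Finset.sum_congr rfl fun j hj => ?_
  have hj' : j ≤ w.length := by simpa [Nat.lt_succ_iff] using hj
  rw [← sum_rotate_add (fun v => b (v.take j) * a (v.drop j)) w (w.length + 1 - 1 - j)]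
  refine Finset.sum_congr rfl fun i _ => ?_
  rw [← List.rotate_rotate, mul_comm]
  set v := w.rotate i with hv
  have hlen : v.length = w.length := by simp [hv]
  have h1 : v.rotate (w.length + 1 - 1 - j) =
      v.drop (w.length + 1 - 1 - j) ++ v.take (w.length + 1 - 1 - j) :=
    List.rotate_eq_drop_append_take (by omega)
  have h2 : (v.drop (w.length + 1 - 1 - j)).length = j := by
    rw [List.length_drop]; omega
  rw [h1, List.take_left' h2, List.drop_left' h2]

theorem trKer_le_ker_cyc : trKer k n ≤ LinearMap.ker cyc := by
  rw [trKer, Submodule.span_le]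
  rintro c (rfl | ⟨a, b, rfl⟩)
  · rw [SetLike.mem_coe, LinearMap.mem_ker]
    ext w
    rw [cyc_apply, Ass.zero_apply]
    refine Finset.sum_eq_zero fun i hi => ?_
    rw [Ass.one_apply, if_neg]
    intro h
    have := congrArg List.length h
    simp only [List.length_rotate, List.length_nil] at this
    simp [this] at hi
  · rw [SetLike.mem_coe, LinearMap.mem_ker, map_sub, cyc_mul_comm, sub_self]

theorem mul_X_append (f : Ass k n) (i j : Fin n) (w : List (Fin n)) :
    (f * X i : Ass k n) (w ++ [j]) = if i = j then f w else 0 := by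
  rw [Ass.mul_apply, Finset.sum_eq_single w.length]
  · rw [List.take_left' rfl, List.drop_left' rfl]
    by_cases h : i = j
    · simp [X, h]
    · simp [X, h, Ne.symm h]
  · intro l hl hne
    have : (X i : Ass k n) (List.drop l (w ++ [j])) = 0 := by
      simp only [X, ite_eq_right_iff]
      intro h
      have := congrArg List.length h
      simp at this hl
      omega
    rw [this, mul_zero]
  · simp

theorem X_mul_cons (f : Ass k n) (i j : Fin n) (w : List (Fin n)) :
    (X i * f : Ass k n) (j :: w) = if i = j then f w else 0 := by
  have h : Ass.lshift j (X i : Ass k n) = if i = j then 1 else 0 := by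
    ext v
    by_cases h : i = j
    · subst h; simp [Ass.lshift, X, Ass.one_apply]
    · simp [Ass.lshift, X, h, Ne.symm h]
  rw [Ass.mul_cons, X_nil, zero_mul, zero_add, h]
  split_ifs <;> simp

/-- The defining property of the operators `∂_i`. -/
theorem eq_add_sum_partialR_mul (f : Ass k n) : f = f [] • 1 + ∑ i, partialR i f * X i := by
  ext w
  rw [Ass.add_apply, Ass.smul_apply, Ass.sum_apply, Ass.one_apply]
  rcases List.eq_nil_or_concat w with rfl | ⟨v, j, rfl⟩
  · simp [X_nil]
  · simp only [List.concat_eq_append, mul_X_append]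
    simp [partialR]

/-- Rotation of words by one letter. -/
def rot (f : Ass k n) : Ass k n := ⟨fun w => f (w.rotate 1)⟩

theorem rot_eq (f : Ass k n) : rot f = f [] • 1 + ∑ i, X i * partialR i f := by
  ext w
  rw [Ass.add_apply, Ass.smul_apply, Ass.sum_apply, Ass.one_apply]
  cases w with
  | nil => simp [X_nil, rot]
  | cons j v =>
    simp only [X_mul_cons]
    simp [partialR, rot]

/-- The difference is the sum over the letters of the commutators of ∂_i f with x_i. It is a finite
combination even when f is an infinite series, as the algebraic span requires. -/
theorem sub_rot_mem_trKer (f : Ass k n) : f - rot f ∈ trKer k n := by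
  rw [rot_eq]
  nth_rw 1 [eq_add_sum_partialR_mul f]
  rw [add_sub_add_left_eq_sub, ← Finset.sum_sub_distrib]
  exact sum_mem fun i _ => Submodule.subset_span (Or.inr ⟨_, _, rfl⟩)

theorem one_mem_trKer : (1 : Ass k n) ∈ trKer k n := Submodule.subset_span (Or.inl rfl)

/-- The span of the commutators and the constants is closed: it is defined by the vanishing of the
sums over the cyclic rotations. -/
theorem mem_trKer_iff [CharZero k] {f : Ass k n} : f ∈ trKer k n ↔ cyc f = 0 := by
  refine ⟨fun h => trKer_le_ker_cyc h, fun h => ?_⟩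
  -- A discrete antiderivative along rotations: on a nonempty word, g - rot g equals f minus the
  -- average of f over all rotations, and this average vanishes by hypothesis.
  set g : Ass k n := ⟨fun w => (w.length : k)⁻¹ *
    ∑ i ∈ Finset.range w.length, ∑ j ∈ Finset.range i, f (w.rotate j)⟩ with hg
  have : f = f [] • 1 + (g - rot g) := by
    ext w
    rw [Ass.add_apply, Ass.smul_apply, Ass.one_apply, Ass.sub_apply]
    by_cases hw : w = []
    · subst hw; simp [rot]
    · have h0 : (w.length : k) ≠ 0 := Nat.cast_ne_zero.2 (by simpa using hw)
      have h1 := congrFun (congrArg Ass.coeff h) w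
      simp only [rot, hg, List.length_rotate, if_neg hw, mul_zero, zero_add]
      rw [← mul_sub, ← Finset.sum_sub_distrib, eq_inv_mul_iff_mul_eq₀ h0]
      have h2 : ∀ i, ∑ j ∈ Finset.range i, f (w.rotate j) -
          ∑ j ∈ Finset.range i, f ((w.rotate 1).rotate j) = f w - f (w.rotate i) := by
        intro i
        rw [← Finset.sum_sub_distrib]
        simp only [List.rotate_rotate, add_comm 1]
        rw [Finset.sum_range_sub' (fun j => f (w.rotate j)), List.rotate_zero]
      simp only [h2, Finset.sum_sub_distrib]
      rw [← cyc_apply, h1]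
      simp
  rw [this]
  exact add_mem (Submodule.smul_mem _ _ one_mem_trKer) (sub_rot_mem_trKer g)

theorem Tr_eq_zero {f : Ass k n} : Tr f = 0 ↔ f ∈ trKer k n :=
  Submodule.Quotient.mk_eq_zero _

theorem Tr_eq_Tr {f g : Ass k n} : Tr f = Tr g ↔ f - g ∈ trKer k n :=
  Submodule.Quotient.eq _

theorem Tr_surjective : Function.Surjective (Tr : Ass k n → tr k n) :=
  Submodule.mkQ_surjective _

theorem Tr_mul_comm (a b : Ass k n) : Tr (a * b) = Tr (b * a) :=
  Tr_eq_Tr.2 (Submodule.subset_span (Or.inr ⟨a, b, rfl⟩))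

/-- The span allows only finite combinations, but its description as the kernel of `cyc` is a
condition on each coefficient and passes to limits. -/
theorem lsum_mem_trKer [CharZero k] {f : ℕ → Ass k n} (hf : ∀ r, f r ∈ trKer k n) :
    lsum f ∈ trKer k n := by
  rw [mem_trKer_iff]
  ext w
  have h : ∀ r, ∑ i ∈ Finset.range w.length, f r (w.rotate i) = 0 := fun r =>
    congrFun (congrArg Ass.coeff (mem_trKer_iff.1 (hf r))) w
  simp only [cyc_apply, Ass.lsum_apply, List.length_rotate]
  rw [Finset.sum_comm]
  exact Finset.sum_eq_zero fun r _ => h r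

theorem partialR_add (i : Fin n) (f g : Ass k n) :
    partialR i (f + g) = partialR i f + partialR i g := rfl

theorem partialR_sub (i : Fin n) (f g : Ass k n) :
    partialR i (f - g) = partialR i f - partialR i g := rfl

theorem partialR_sum (i : Fin n) {ι : Type*} (s : Finset ι) (f : ι → Ass k n) :
    partialR i (∑ j ∈ s, f j) = ∑ j ∈ s, partialR i (f j) := by
  ext w
  rw [Ass.sum_apply]
  exact Ass.sum_apply s f _

theorem partialR_mul (i : Fin n) (f g : Ass k n) :
    partialR i (f * g) = f * partialR i g + g [] • partialR i f := by
  ext w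
  rw [Ass.add_apply, Ass.smul_apply, Ass.mul_apply]
  change (f * g) (w ++ [i]) = _
  rw [Ass.mul_apply, List.length_append, List.length_singleton, Finset.sum_range_succ]
  congr 1
  · refine Finset.sum_congr rfl fun j hj => ?_
    have hj' : j ≤ w.length := by simpa [Nat.lt_succ_iff] using hj
    rw [List.take_append_of_le_length hj', List.drop_append_of_le_length hj']
    rfl
  · rw [List.take_of_length_le (by simp), List.drop_of_length_le (by simp), mul_comm]
    rfl

theorem partialR_X (i j : Fin n) : partialR i (X j : Ass k n) = if j = i then 1 else 0 := by
  ext w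
  cases w with
  | nil =>
    by_cases h : j = i
    · simp [partialR, X, h, Ass.one_apply]
    · simp [partialR, X, h, Ne.symm h]
  | cons a w =>
    have : (a :: w) ++ [i] ≠ [j] := fun h => by
      have := congrArg List.length h
      simp at this
    by_cases h : j = i <;> simp [partialR, X, h, Ass.one_apply]

end Trace

/-! ### The divergence as a Lie algebra cocycle -/

namespace TDer

variable {k : Type*} [Field k] {n : ℕ}

theorem toEnd_one (u : TDer k n) : u.toEnd 1 = 0 := by simpa using u.leibniz 1 1

theorem toEnd_mem_trKer (u : TDer k n) {f : Ass k n} (hf : f ∈ trKer k n) :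
    u.toEnd f ∈ trKer k n := by
  have : trKer k n ≤ (trKer k n).comap u.toEnd := by
    conv_lhs => rw [trKer]
    rw [Submodule.span_le]
    rintro c (rfl | ⟨a, b, rfl⟩)
    · rw [SetLike.mem_coe, Submodule.mem_comap, u.toEnd_one]
      exact zero_mem _
    · rw [SetLike.mem_coe, Submodule.mem_comap, toEnd_bracket]
      exact add_mem (Submodule.subset_span (Or.inr ⟨_, _, rfl⟩))
        (Submodule.subset_span (Or.inr ⟨_, _, rfl⟩))
  exact this hf

/-- Apply u to b = b₀ + ∑ (∂_l b) x_l and differentiate again. The two correction terms come from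
u(x_l) = x_l a_l - a_l x_l, where a_l has no constant term. -/
theorem partialR_toEnd (u : TDer k n) (i : Fin n) (b : Ass k n) :
    partialR i (u.toEnd b) = u.toEnd (partialR i b) - partialR i b * u.comp i +
      ∑ l, partialR l b * X l * partialR i (u.comp l) := by
  conv_lhs => rw [eq_add_sum_partialR_mul b]
  rw [map_add, map_smul, u.toEnd_one, smul_zero, zero_add, map_sum, partialR_sum]
  have h : ∀ l, partialR i (u.toEnd (partialR l b * X l)) =
      (if l = i then u.toEnd (partialR i b) - partialR i b * u.comp i else 0) +
        partialR l b * X l * partialR i (u.comp l) := by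
    intro l
    rw [u.leibniz, u.map_X, partialR_add, partialR_mul, partialR_mul, partialR_sub, partialR_mul,
      partialR_mul, partialR_X, Ass.sub_apply, Ass.mul_nil, Ass.mul_nil, X_nil, u.comp_nil]
    by_cases h : l = i
    · subst h; simp [mul_sub, mul_assoc]; abel
    · simp [h, mul_assoc]
  simp only [h, Finset.sum_add_distrib]
  simp

/-- The divergence is a one-cocycle. -/
theorem divRep_bracket (u v : TDer k n) :
    Tr (⁅u, v⁆).divRep = Tr (u.toEnd v.divRep - v.toEnd u.divRep) := by
  set a := u.comp with ha
  set b := v.comp with hb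
  set p : Fin n → Fin n → Ass k n := fun i l => X i * partialR l (b i) with hp
  set q : Fin n → Fin n → Ass k n := fun i l => X i * partialR l (a i) with hq
  have h1 : ∀ i, X i * partialR i (⁅u, v⁆.comp i) =
      (u.toEnd (p i i) - v.toEnd (q i i)) +
        ((a i * p i i - p i i * a i) + (q i i * b i - b i * q i i)) +
        ∑ l, (p i l * q l i - q i l * p l i) := by
    intro i
    rw [bracket_comp, partialR_add, partialR_sub, partialR_sub, partialR_toEnd, partialR_toEnd,
      partialR_mul, partialR_mul, u.comp_nil, v.comp_nil, zero_smul, zero_smul, ← ha, ← hb]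
    simp only [hp, hq, u.leibniz, v.leibniz, u.map_X, v.map_X, ← ha, ← hb]
    rw [Finset.sum_sub_distrib]
    simp only [mul_add, mul_sub, Finset.mul_sum]
    noncomm_ring
  -- As for the trace of a product of two matrices: exchanging the indices and using cyclicity
  -- cancels the quadratic terms.
  have h2 : ∑ i, ∑ l, Tr (p i l * q l i) = ∑ i, ∑ l, Tr (q i l * p l i) := by
    rw [Finset.sum_comm]
    exact Finset.sum_congr rfl fun i _ => Finset.sum_congr rfl fun l _ => Tr_mul_comm _ _
  have h3 : (⁅u, v⁆).divRep = ∑ i, X i * partialR i (⁅u, v⁆.comp i) := rfl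
  have h4 : v.divRep = ∑ i, p i i := rfl
  have h5 : u.divRep = ∑ i, q i i := rfl
  rw [h3, h4, h5]
  simp only [h1, map_sum, map_add, map_sub, Finset.sum_add_distrib, Finset.sum_sub_distrib, h2,
    Tr_mul_comm (a _) (p _ _), Tr_mul_comm (b _) (q _ _), sub_self, add_zero]

end TDer

/-! ### Series of operators compatible with a quotient map -/

section Intertwining

variable {k : Type*} [Field k] {M N : Type*} [AddCommGroup M] [Module k M] [AddCommGroup N]
  [Module k N]

/-- The coefficients of two series of operators are intertwined by `π`. -/
def Intertwines (π : M →ₗ[k] N) (P : PowerSeries (Module.End k M))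
    (P' : PowerSeries (Module.End k N)) : Prop :=
  ∀ n f, PowerSeries.coeff n P' (π f) = π (PowerSeries.coeff n P f)

variable {π : M →ₗ[k] N} {P Q : PowerSeries (Module.End k M)} {P' Q' : PowerSeries (Module.End k N)}

theorem Intertwines.mul (h : Intertwines π P P') (h' : Intertwines π Q Q') :
    Intertwines π (P * Q) (P' * Q') := fun n f => by
  rw [PowerSeries.coeff_mul, PowerSeries.coeff_mul, LinearMap.sum_apply, LinearMap.sum_apply,
    map_sum]
  exact Finset.sum_congr rfl fun p _ => by
    rw [Module.End.mul_apply, Module.End.mul_apply, h', h]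

theorem Intertwines.one : Intertwines π 1 1 := fun n f => by
  rw [PowerSeries.coeff_one, PowerSeries.coeff_one]
  split_ifs <;> simp

theorem Intertwines.pow (h : Intertwines π P P') (r : ℕ) : Intertwines π (P ^ r) (P' ^ r) := by
  induction r with
  | zero => simpa using Intertwines.one
  | succ r ih => rw [pow_succ, pow_succ]; exact ih.mul h

theorem Intertwines.ser (h : Intertwines π P P') (c : PowerSeries k) :
    Intertwines π (ser c P) (ser c P') := fun n f => by
  simp only [KashiwaraVergne.ser, coeff_lsum, LinearMap.sum_apply, map_sum,
    PowerSeries.coeff_smul, LinearMap.smul_apply, map_smul]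
  exact Finset.sum_congr rfl fun r _ => by rw [h.pow r n f]

theorem Intertwines.expT {T : Module.End k M} {T' : Module.End k N}
    (h : ∀ f, T' (π f) = π (T f)) : Intertwines π (expT k T) (expT k T') := fun n f => by
  simp only [KashiwaraVergne.expT, PowerSeries.coeff_mk, LinearMap.smul_apply, map_smul]
  congr 1
  induction n generalizing f with
  | zero => simp
  | succ n ih => rw [pow_succ, pow_succ, Module.End.mul_apply, Module.End.mul_apply, h, ih]

end Intertwining

/-! ### The affine action and the group cocycle j -/

namespace TDer

variable {k : Type*} [Field k] {n : ℕ}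

variable (k n) in
/-- The constant term. -/
def constTerm : Ass k n →ₗ[k] k where
  toFun f := f []
  map_add' _ _ := rfl
  map_smul' _ _ := rfl

/-- The affine action of a tangential derivation on `Ass_n = k ⊕ Ass_n⁺`: the derivation itself,
together with its divergence on the constants. -/
def affine (u : TDer k n) : Module.End k (Ass k n) :=
  u.toEnd + (constTerm k n).smulRight u.divRep

theorem affine_apply (u : TDer k n) (f : Ass k n) :
    u.affine f = u.toEnd f + f [] • u.divRep := rfl

theorem affine_zero : (0 : TDer k n).affine = 0 := by
  refine LinearMap.ext fun f => ?_
  rw [affine_apply, divRep_eq, zero_toEnd]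
  simp [zero_comp]

theorem divRep_nil (u : TDer k n) : u.divRep [] = 0 := divRep_mem u.hasOrder_one [] one_pos

theorem toEnd_nil (u : TDer k n) (f : Ass k n) : u.toEnd f [] = 0 :=
  End.apply_mem u.toEnd_mem_fil f [] one_pos

theorem affine_nil (u : TDer k n) (f : Ass k n) : u.affine f [] = 0 := by
  simp [affine_apply, divRep_nil, toEnd_nil]

theorem affine_of_nil (u : TDer k n) {f : Ass k n} (hf : f [] = 0) : u.affine f = u.toEnd f := by
  rw [affine_apply, hf, zero_smul, add_zero]

theorem HasOrder.affine_mem {u : TDer k n} {m : ℕ} (hu : u.HasOrder m) : u.affine ∈ fil m := by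
  intro p f hf
  rw [affine_apply]
  refine add_mem (hu.1 p f hf) ?_
  rcases Nat.eq_zero_or_pos p with rfl | hp
  · rw [zero_add]
    exact FiltrationSMul.smul_mem _ (divRep_mem hu)
  · rw [hf [] hp, zero_smul]
    exact zero_mem _

variable (k n) in
/-- The span of the commutators. -/
def commKer : Submodule k (Ass k n) := trKer k n ⊓ LinearMap.ker (constTerm k n)

theorem mem_commKer {f : Ass k n} : f ∈ commKer k n ↔ f ∈ trKer k n ∧ f [] = 0 := Iff.rfl

/-- Constants must survive in the quotient, since the affine action stores the divergence as the
image of 1; this is why `commKer` replaces `trKer`. On series without constant term the affine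
action is just u. -/
theorem affine_mem_commKer (u : TDer k n) : commKer k n ≤ (commKer k n).comap u.affine :=
  fun f hf => by
    rw [mem_commKer] at hf
    rw [Submodule.mem_comap, mem_commKer, affine_of_nil u hf.2]
    exact ⟨u.toEnd_mem_trKer hf.1, u.toEnd_nil f⟩

/-- The defect is the constant term of f times the cocycle defect of `divRep`, which
`divRep_bracket` places among the commutators. -/
theorem affine_bracket (u v : TDer k n) (f : Ass k n) :
    u.affine (v.affine f) - v.affine (u.affine f) - (⁅u, v⁆).affine f ∈ commKer k n := by
  have h : u.affine (v.affine f) - v.affine (u.affine f) - (⁅u, v⁆).affine f =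
      -(f [] • ((⁅u, v⁆).divRep - (u.toEnd v.divRep - v.toEnd u.divRep))) := by
    rw [affine_of_nil u (v.affine_nil f), affine_of_nil v (u.affine_nil f), affine_apply,
      affine_apply, affine_apply, bracket_toEnd]
    simp only [map_add, map_smul, LinearMap.sub_apply, Module.End.mul_apply, smul_sub]
    abel
  rw [h]
  refine neg_mem (Submodule.smul_mem _ _ ⟨Tr_eq_Tr.1 (divRep_bracket u v), ?_⟩)
  change (_ - (_ - _) : Ass k n) [] = 0
  simp [divRep_nil, toEnd_nil]

theorem affine_sum (w : ℕ → TDer k n) (hw : ∀ r, (w r).HasOrder r) :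
    (sum w hw).affine = lsum fun r => (w r).affine := by
  refine LinearMap.ext fun f => ?_
  rw [affine_apply, divRep_sum, ← lsum_smul _ fun r => divRep_mem (hw r)]
  exact (lsum_add (fun r => End.apply_mem (hw r).1 f)
    fun r => FiltrationSMul.smul_mem _ (divRep_mem (hw r))).symm

variable (k n) in
/-- The pairs consisting of a tangential derivation raising the degree by `m` and of its affine
action modulo the commutators. -/
def affinePairs (m : ℕ) :
    Submodule k (Module.End k (Ass k n) × Module.End k (Ass k n ⧸ commKer k n)) where
  carrier := {T | ∃ u : TDer k n, u.HasOrder m ∧ T.1 = u.toEnd ∧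
    ∀ f, T.2 ((commKer k n).mkQ f) = (commKer k n).mkQ (u.affine f)}
  add_mem' := by
    rintro a b ⟨u, hu, h1, h2⟩ ⟨v, hv, h3, h4⟩
    refine ⟨u + v, hu.add hv, by rw [Prod.fst_add, h1, h3]; rfl, fun f => ?_⟩
    rw [Prod.snd_add, LinearMap.add_apply, h2, h4, ← map_add]
    congr 1
    simp only [affine_apply, divRep_add, add_toEnd, LinearMap.add_apply, smul_add]
    abel
  zero_mem' := by
    refine ⟨0, hasOrder_zero m, rfl, fun f => ?_⟩
    rw [affine_zero, LinearMap.zero_apply, map_zero]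
    rfl
  smul_mem' := by
    rintro c a ⟨u, hu, h1, h2⟩
    refine ⟨c • u, hu.smul c, by rw [Prod.smul_fst, h1]; rfl, fun f => ?_⟩
    rw [Prod.smul_snd, LinearMap.smul_apply, h2, ← map_smul]
    congr 1
    simp only [affine_apply, divRep_smul, smul_toEnd, LinearMap.smul_apply, smul_add]
    rw [smul_comm c]

/-- Provides the graded Lie algebra for BCH: one derivation controls both components, exactly in the
first and modulo commutators in the second. -/
theorem bracket_mem_affinePairs {p q : ℕ}
    {a b : Module.End k (Ass k n) × Module.End k (Ass k n ⧸ commKer k n)}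
    (ha : a ∈ affinePairs k n p) (hb : b ∈ affinePairs k n q) :
    a * b - b * a ∈ affinePairs k n (p + q) := by
  obtain ⟨u, hu, h1, h2⟩ := ha
  obtain ⟨v, hv, h3, h4⟩ := hb
  refine ⟨⁅u, v⁆, hu.bracket hv, ?_, fun f => ?_⟩
  · rw [Prod.fst_sub, Prod.fst_mul, Prod.fst_mul, h1, h3, bracket_toEnd]
  · rw [Prod.snd_sub, Prod.snd_mul, Prod.snd_mul, LinearMap.sub_apply, Module.End.mul_apply,
      Module.End.mul_apply, h4, h2, h2, h4, ← map_sub, ← sub_eq_zero, ← map_sub]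
    exact (Submodule.Quotient.mk_eq_zero _).2 (affine_bracket u v f)

theorem exp_eq_ser (u : TDer k n) : u.exp = ser (expS k) u.toEnd := by
  rw [← opSeries_eq_ser]
  simp only [expS, PowerSeries.coeff_mk]
  rfl

/-- The representative of `j(exp(u))`. -/
def jRep (u : TDer k n) : Ass k n := ser (phiS k) u.toEnd u.divRep

theorem j_eq (u : TDer k n) : u.j = Tr u.jRep := by
  rw [jRep, ← opSeries_eq_ser]
  simp only [phiS, PowerSeries.coeff_mk]
  rfl

theorem affine_pow_of_nil (u : TDer k n) {f : Ass k n} (hf : f [] = 0) (r : ℕ) :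
    (u.affine ^ r) f = (u.toEnd ^ r) f := by
  have : (u.affine ^ r) f = (u.toEnd ^ r) f ∧ (u.toEnd ^ r) f [] = 0 := by
    induction r with
    | zero => exact ⟨rfl, hf⟩
    | succ r ih =>
      rw [pow_succ', pow_succ', Module.End.mul_apply, Module.End.mul_apply, ih.1,
        affine_of_nil u ih.2]
      exact ⟨rfl, u.toEnd_nil _⟩
  exact this.1

theorem ser_affine_of_nil (c : PowerSeries k) (u : TDer k n) {f : Ass k n} (hf : f [] = 0) :
    ser c u.affine f = ser c u.toEnd f := by
  simp only [ser, End.lsum_apply, LinearMap.smul_apply, affine_pow_of_nil u hf]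

/-- The power r + 1 of the affine operator sends 1 to u^r(div u), and its weight 1/(r + 1)! is the
one occurring in j. -/
theorem exp_affine_one (u : TDer k n) : ser (expS k) u.affine 1 = 1 + u.jRep := by
  have h1 : ∀ r, (u.affine ^ (r + 1)) 1 = (u.toEnd ^ r) u.divRep := fun r => by
    rw [pow_succ, Module.End.mul_apply, affine_apply, u.toEnd_one, zero_add, Ass.one_apply,
      if_pos rfl, one_smul, affine_pow_of_nil u u.divRep_nil]
  ext w
  rw [Ass.add_apply]
  simp only [jRep, ser, End.lsum_apply, Ass.lsum_apply, LinearMap.smul_apply, Ass.smul_apply]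
  rw [Finset.sum_range_succ', Finset.sum_range_succ (n := w.length)]
  -- After the index shift the truncated sum for j has one term more than the exponential; that term
  -- vanishes by degree.
  have h2 : (u.toEnd ^ w.length) u.divRep w = 0 := by
    have := pow_mem_fil u.toEnd_mem_fil w.length 1 _ (divRep_mem u.hasOrder_one)
    exact this w (by omega)
  simp only [h1, h2, expS, phiS, PowerSeries.coeff_mk]
  simp [add_comm]

theorem jRep_nil (u : TDer k n) : u.jRep [] = 0 := by
  simp [jRep, ser, End.lsum_apply, Ass.lsum_apply, divRep_nil]

/-- The exponentials of tangential derivations are closed under composition, and `j` is a group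
cocycle. -/
theorem exists_exp_eq_mul [CharZero k] (u v : TDer k n) :
    ∃ w : TDer k n, w.exp = u.exp * v.exp ∧ w.j = u.j + Tr (u.exp v.jRep) := by
  set C := commKer k n
  have hp : ∀ u : TDer k n, (u.toEnd, C.mapQ C u.affine u.affine_mem_commKer) ∈
      affinePairs k n 1 := fun u => ⟨u, u.hasOrder_one, rfl, fun f => rfl⟩
  obtain ⟨W, hW, hWL, hWe⟩ := exists_exp_eq_expT_mul (affinePairs k n) bracket_mem_affinePairs
    (hp u) (hp v)
  -- The coefficients of W are lifted to derivations. In degree zero the lift 0 is imposed, so that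
  -- the lifted series below has no constant coefficient.
  have hex : ∀ r, ∃ w : TDer k n, w.HasOrder r ∧ (PowerSeries.coeff r W).1 = w.toEnd ∧
      (∀ f, (PowerSeries.coeff r W).2 (C.mkQ f) = C.mkQ (w.affine f)) ∧ (r = 0 → w = 0) := by
    intro r
    rcases Nat.eq_zero_or_pos r with rfl | hr
    · refine ⟨0, hasOrder_zero 0, by rw [hW 0 one_pos]; rfl, fun f => ?_, fun _ => rfl⟩
      rw [hW 0 one_pos, affine_zero, LinearMap.zero_apply, map_zero]
      rfl
    · obtain ⟨w, h1, h2, h3⟩ := hWL r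
      exact ⟨w, h1, h2, h3, fun h => absurd h hr.ne'⟩
  choose w hw1 hw2 hw3 hw0 using hex
  refine ⟨sum w hw1, ?_, ?_⟩
  · set φ := PowerSeries.map (RingHom.fst (Module.End k (Ass k n)) (Module.End k (Ass k n ⧸ C)))
    have hφ : ∀ N, ∀ P ∈ fil N, φ P ∈ fil N := fun N P h m hm => by
      rw [PowerSeries.coeff_map, h m hm, map_zero]
    have hg : IsGraded (φ W) := fun r => by
      rw [PowerSeries.coeff_map, RingHom.coe_fst, hw2]; exact (hw1 r).1
    have h1 := congrArg φ hWe
    have h2 : ∀ u, φ (expT k u) = expT k u.1 := fun u => by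
      ext r : 1
      simp [φ, expT, PowerSeries.coeff_map]
    rw [map_ser φ hφ (fun c a => by ext r : 1; simp [φ, PowerSeries.coeff_map]) _ hW, map_mul, h2,
      h2] at h1
    have h3 := congrArg evalOne h1
    rw [evalOne_ser _ hg (hφ 1 W hW), evalOne_mul (IsGraded.expT u.toEnd_mem_fil)
      (IsGraded.expT v.toEnd_mem_fil), evalOne_expT, evalOne_expT, ← exp_eq_ser, ← exp_eq_ser]
      at h3
    rw [← h3, exp_eq_ser]
    congr 1
    change lsum _ = lsum _
    congr 1
    funext r
    rw [PowerSeries.coeff_map, RingHom.coe_fst, hw2]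
  · set φ := PowerSeries.map (RingHom.snd (Module.End k (Ass k n)) (Module.End k (Ass k n ⧸ C)))
    have hφ : ∀ N, ∀ P ∈ fil N, φ P ∈ fil N := fun N P h m hm => by
      rw [PowerSeries.coeff_map, h m hm, map_zero]
    have h1 := congrArg φ hWe
    have h2 : ∀ u, φ (expT k u) = expT k u.2 := fun u => by
      ext r : 1
      simp [φ, expT, PowerSeries.coeff_map]
    rw [map_ser φ hφ (fun c a => by ext r : 1; simp [φ, PowerSeries.coeff_map]) _ hW, map_mul, h2,
      h2] at h1
    -- No filtration is put on the endomorphisms of the quotient, so t = 1 is not set there. The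
    -- second component is lifted to operators on `Ass`, evaluated at t = 1 there, and compared
    -- coefficient by coefficient through `Intertwines`.
    set V : PowerSeries (Module.End k (Ass k n)) := PowerSeries.mk fun r => (w r).affine with hV
    have hVg : IsGraded V := fun r => by
      rw [hV, PowerSeries.coeff_mk]; exact (hw1 r).affine_mem
    have hV1 : V ∈ fil 1 := fun m hm => by
      obtain rfl : m = 0 := by omega
      rw [hV, PowerSeries.coeff_mk, hw0 0 rfl, affine_zero]
    have hI : Intertwines C.mkQ V (φ W) := fun r f => by
      rw [PowerSeries.coeff_map, RingHom.coe_snd, hw3, hV, PowerSeries.coeff_mk]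
    have hI1 := hI.ser (expS k)
    have hI2 : Intertwines C.mkQ (expT k u.affine * expT k v.affine) (ser (expS k) (φ W)) := by
      rw [h1]
      exact (Intertwines.expT (π := C.mkQ) (T := u.affine) fun f => rfl).mul
        (Intertwines.expT (π := C.mkQ) (T := v.affine) fun f => rfl)
    have hua := u.hasOrder_one.affine_mem
    have hva := v.hasOrder_one.affine_mem
    have e1 : evalOne (ser (expS k) V) 1 = 1 + (sum w hw1).jRep := by
      have : evalOne V = (sum w hw1).affine := by
        rw [affine_sum]
        simp only [evalOne, hV, PowerSeries.coeff_mk]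
      rw [evalOne_ser _ hVg hV1, this, exp_affine_one]
    have e2 : evalOne (expT k u.affine * expT k v.affine) 1 =
        1 + u.jRep + u.exp v.jRep := by
      rw [evalOne_mul (IsGraded.expT hua) (IsGraded.expT hva), evalOne_expT, evalOne_expT,
        Module.End.mul_apply, exp_affine_one, map_add, exp_affine_one,
        ser_affine_of_nil _ _ v.jRep_nil, exp_eq_ser]
    -- Each power of t contributes an element of `trKer`; closedness handles their infinite sum.
    have h3 : evalOne (ser (expS k) V) 1 - evalOne (expT k u.affine * expT k v.affine) 1 ∈
        trKer k n := by
      have h4 : evalOne (ser (expS k) V) 1 - evalOne (expT k u.affine * expT k v.affine) 1 =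
          lsum fun r => PowerSeries.coeff r (ser (expS k) V) 1 -
            PowerSeries.coeff r (expT k u.affine * expT k v.affine) 1 := by
        ext x
        simp [evalOne, End.lsum_apply, Ass.lsum_apply]
      rw [h4]
      refine lsum_mem_trKer fun r => ?_
      have h5 := (hI1 r 1).symm.trans (hI2 r 1)
      exact (mem_commKer.1 ((Submodule.Quotient.eq _).1 h5)).1
    rw [e1, e2] at h3
    rw [j_eq, j_eq, ← map_add, Tr_eq_Tr]
    convert h3 using 1
    abel

end TDer

/-! ### Substitution, continuity and relabelling of letters -/

section Substitution

variable {k : Type*} [Field k] {m n p : ℕ}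

theorem subst_sub_mem {s : Fin m → Ass k n} (hs : ∀ i, s i [] = 0) (f : Ass k m) (N : ℕ) :
    subst s hs f - ∑ v ∈ wordsLE m N, f v • wordProd s v ∈ fil (N + 1) := by
  intro w hw
  rw [Ass.sub_apply, Ass.sum_apply]
  change substFun s f w - _ = 0
  rw [substFun_apply hs f w (Nat.lt_succ_iff.1 hw), sub_eq_zero]
  rfl

/-- Up to any given order a substitution is a finite combination of products of the s_i. On such
products multiplicativity suffices, and φ preserves the order of the remainder. -/
theorem map_subst (φ : Ass k n →ₗ[k] Ass k p) (h1 : φ 1 = 1) (hm : ∀ f g, φ (f * g) = φ f * φ g)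
    (hφ : ∀ N, ∀ f ∈ fil N, φ f ∈ fil N) {s : Fin m → Ass k n} (hs : ∀ i, s i [] = 0)
    {t : Fin m → Ass k p} (ht : ∀ i, t i [] = 0) (hst : ∀ i, φ (s i) = t i) (f : Ass k m) :
    φ (subst s hs f) = subst t ht f := by
  have hw : ∀ v, φ (wordProd s v) = wordProd t v := by
    intro v
    induction v with
    | nil => simpa [wordProd] using h1
    | cons a v ih =>
      simp only [wordProd, List.map_cons, List.prod_cons] at ih ⊢
      rw [hm, ih, hst]
  refine eq_of_sub_mem_fil fun N => fil_le (Nat.le_succ N) ?_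
  have h2 := hφ _ _ (subst_sub_mem hs f N)
  rw [map_sub, map_sum] at h2
  simp only [map_smul, hw] at h2
  simpa using sub_mem h2 (subst_sub_mem ht f N)

/-- A continuous derivation vanishes on the series in elements which it annihilates. -/
theorem derivation_subst (D : Module.End k (Ass k n)) (hD : ∀ f g, D (f * g) = D f * g + f * D g)
    (hf : D ∈ fil 0) {s : Fin m → Ass k n} (hs : ∀ i, s i [] = 0) (h : ∀ i, D (s i) = 0)
    (f : Ass k m) : D (subst s hs f) = 0 := by
  have hw : ∀ v, D (wordProd s v) = 0 := by
    intro v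
    induction v with
    | nil => simpa [wordProd] using hD 1 1
    | cons a v ih =>
      simp only [wordProd, List.map_cons, List.prod_cons] at ih ⊢
      rw [hD, ih, h, zero_mul, mul_zero, add_zero]
  refine eq_zero_of_mem fun N => fil_le (Nat.le_succ N) ?_
  have h2 := hf _ _ (subst_sub_mem hs f N)
  rw [map_sub, map_sum] at h2
  simpa only [map_smul, hw, smul_zero, Finset.sum_const_zero, sub_zero] using h2

/-- Substitution of sums of distinct letters: the letters of `S` are replaced according to `ρ`. -/
theorem subst_letters_apply {s : Fin m → Ass k n} (hs : ∀ i, s i [] = 0) (S : Finset (Fin n))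
    (ρ : Fin n → Fin m) (h : ∀ i, s i = ∑ j ∈ S, if ρ j = i then X j else 0) (f : Ass k m)
    (w : List (Fin n)) : subst s hs f w = if ∀ j ∈ w, j ∈ S then f (w.map ρ) else 0 := by
  have hw : ∀ v w, wordProd s v w = if (∀ j ∈ w, j ∈ S) ∧ w.map ρ = v then 1 else 0 := by
    intro v
    induction v with
    | nil =>
      intro w
      cases w <;> simp [wordProd, Ass.one_apply]
    | cons a v ih =>
      intro w
      have e : wordProd s (a :: v) = s a * wordProd s v := by simp [wordProd]
      rw [e]
      cases w with
      | nil => simp [hs]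
      | cons j w =>
        have e2 : s a * wordProd s v =
            ∑ l ∈ S, (if ρ l = a then 1 else 0 : k) • (X l * wordProd s v) := by
          conv_lhs => rw [h, Finset.sum_mul]
          exact Finset.sum_congr rfl fun l _ => by split_ifs <;> simp
        rw [e2, Ass.sum_apply]
        simp only [Ass.smul_apply, X_mul_cons, ih]
        by_cases hj : j ∈ S
        · rw [Finset.sum_eq_single j (fun l _ hl => by simp [hl]) (fun h' => absurd hj h')]
          simp only [if_true, List.forall_mem_cons, List.map_cons, List.cons.injEq, hj,
            true_and]
          by_cases h1 : ρ j = a <;> simp [h1]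
        · rw [Finset.sum_eq_zero fun l hl => by
            rw [if_neg (fun h' : l = j => hj (h' ▸ hl)), mul_zero]]
          simp [hj]
  change ∑ v ∈ wordsLE m w.length, f v * wordProd s v w = _
  simp only [hw]
  by_cases hS : ∀ j ∈ w, j ∈ S
  · rw [if_pos hS, Finset.sum_eq_single (w.map ρ)]
    · simp only [and_true]; rw [if_pos hS, mul_one]
    · intro v _ hv
      rw [if_neg (fun h' => hv h'.2.symm), mul_zero]
    · intro h'
      exact absurd (mem_wordsLE.2 (by simp)) h'
  · rw [if_neg hS]
    exact Finset.sum_eq_zero fun v _ => by rw [if_neg (fun h' => hS h'.1), mul_zero]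

/-- Relabelling letters and having all letters in S are both compatible with rotation. -/
theorem cyc_subst_letters {s : Fin m → Ass k n} (hs : ∀ i, s i [] = 0) (S : Finset (Fin n))
    (ρ : Fin n → Fin m) (h : ∀ i, s i = ∑ j ∈ S, if ρ j = i then X j else 0) (f : Ass k m)
    (w : List (Fin n)) :
    cyc (subst s hs f) w = if ∀ j ∈ w, j ∈ S then cyc f (w.map ρ) else 0 := by
  simp only [cyc_apply, subst_letters_apply hs S ρ h, List.mem_rotate, List.length_map,
    List.map_rotate]
  split_ifs <;> simp

theorem cyc_rotate (f : Ass k n) (w : List (Fin n)) (j : ℕ) : cyc f (w.rotate j) = cyc f w := by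
  simp only [cyc_apply, List.length_rotate, List.rotate_rotate]
  rw [← sum_rotate_add f w j]
  simp only [add_comm]

theorem trMap_Tr (φ : Ass k m →ₐ[k] Ass k n) (f : Ass k m) : trMap φ (Tr f) = Tr (φ f) := rfl

end Substitution

/-! ### The kernel of δ -/

section Cocycles

variable {k : Type*} [Field k]

/-- The series `h(y) - h(x + y) + h(x)`. -/
def addCoboundary (h : Ass k 1) : Ass k 2 :=
  subst ![X 1] (by simp [X_nil]) h - subst ![X 0 + X 1] (by simp [X_nil]) h
    + subst ![X 0] (by simp [X_nil]) h

theorem addCoboundary_neg (h : Ass k 1) : addCoboundary (-h) = -addCoboundary h := by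
  simp only [addCoboundary, map_neg]
  abel

theorem addCoboundary_add (g h : Ass k 1) :
    addCoboundary (g + h) = addCoboundary g + addCoboundary h := by
  simp only [addCoboundary, map_add]
  abel

/-- In one variable all rotations of a word coincide, so `cyc` multiplies the coefficient in degree
d by d. -/
theorem cyc_addCoboundary (h : Ass k 1) (w : List (Fin 2)) : cyc (addCoboundary h) w =
    ((if ∀ j ∈ w, j = 1 then 1 else 0) - 1 + (if ∀ j ∈ w, j = 0 then 1 else 0)) *
      (w.length * h (List.replicate w.length 0)) := by
  have e : ∀ v : List (Fin 2), (v.map fun _ => (0 : Fin 1)) = List.replicate v.length 0 :=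
    fun v => by simp
  have e2 : cyc h (List.replicate w.length 0) = w.length * h (List.replicate w.length 0) := by
    simp [cyc_apply]
  rw [addCoboundary, map_add, map_sub, Ass.add_apply, Ass.sub_apply,
    cyc_subst_letters _ {1} (fun _ => 0) (by simp [Fin.forall_fin_one]),
    cyc_subst_letters _ Finset.univ (fun _ => 0) (by simp [Fin.forall_fin_one]),
    cyc_subst_letters _ {0} (fun _ => 0) (by simp [Fin.forall_fin_one])]
  simp only [e, e2, Finset.mem_singleton, Finset.mem_univ, implies_true, if_true]
  split_ifs <;> ring

/-- Turns the cocycle condition into scalar equations indexed by words in x, y, z. Merging x with y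
serves both f(x + y, z) and, on words without x, f(y, z); merging y with z serves the other two
terms. -/
theorem delta_Tr_eq_zero_iff_cyc [CharZero k] (f : Ass k 2) : delta k (Tr f) = 0 ↔
    ∀ w : List (Fin 3),
      (if ∀ j ∈ w, j ≠ 0 then cyc f (w.map ![0, 0, 1]) else 0) - cyc f (w.map ![0, 0, 1]) +
        cyc f (w.map ![0, 1, 1]) - (if ∀ j ∈ w, j ≠ 2 then cyc f (w.map ![0, 1, 1]) else 0) =
          0 := by
  simp only [delta, LinearMap.sub_apply, LinearMap.add_apply, trMap_Tr]
  rw [← map_sub, ← map_add, ← map_sub, Tr_eq_zero, mem_trKer_iff, Ass.ext_iff, funext_iff]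
  refine forall_congr' fun w => ?_
  rw [map_sub, map_add, map_sub, Ass.sub_apply, Ass.add_apply, Ass.sub_apply,
    cyc_subst_letters _ {1, 2} ![0, 0, 1] (by simp [Fin.forall_fin_two]),
    cyc_subst_letters _ Finset.univ ![0, 0, 1]
      (by simp [Fin.forall_fin_two, Fin.sum_univ_three]),
    cyc_subst_letters _ Finset.univ ![0, 1, 1]
      (by simp [Fin.forall_fin_two, Fin.sum_univ_three]),
    cyc_subst_letters _ {0, 1} ![0, 1, 1] (by simp [Fin.forall_fin_two])]
  have h1 : ∀ j : Fin 3, j ∈ ({1, 2} : Finset (Fin 3)) ↔ j ≠ 0 := by decide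
  have h2 : ∀ j : Fin 3, j ∈ ({0, 1} : Finset (Fin 3)) ↔ j ≠ 2 := by decide
  simp only [h1, h2, Finset.mem_univ, implies_true, if_true, Ass.zero_apply]

theorem delta_addCoboundary [CharZero k] (h : Ass k 1) : delta k (Tr (addCoboundary h)) = 0 := by
  rw [delta_Tr_eq_zero_iff_cyc]
  intro w
  have a1 : ∀ j : Fin 3, (![0, 0, 1] : Fin 3 → Fin 2) j = 1 ↔ j = 2 := by decide
  have a2 : ∀ j : Fin 3, (![0, 0, 1] : Fin 3 → Fin 2) j = 0 ↔ j ≠ 2 := by decide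
  have a3 : ∀ j : Fin 3, (![0, 1, 1] : Fin 3 → Fin 2) j = 1 ↔ j ≠ 0 := by decide
  have a4 : ∀ j : Fin 3, (![0, 1, 1] : Fin 3 → Fin 2) j = 0 ↔ j = 0 := by decide
  simp only [cyc_addCoboundary, List.forall_mem_map, List.length_map, a1, a2, a3, a4]
  have i1 : (∀ j ∈ w, j = 2) → ∀ j ∈ w, j ≠ 0 := fun h j hj => by rw [h j hj]; decide
  have i2 : (∀ j ∈ w, j = 0) → ∀ j ∈ w, j ≠ 2 := fun h j hj => by rw [h j hj]; decide
  split_ifs <;> first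
    | ring1
    | exact absurd (i1 ‹_›) ‹_›
    | exact absurd (i2 ‹_›) ‹_›

/-- The second cohomology of the complex of the `tr_n` vanishes. -/
theorem exists_Tr_eq_of_delta_eq_zero [CharZero k] {f : Ass k 2} (hf : delta k (Tr f) = 0) :
    ∃ h : Ass k 1, Tr f = Tr (addCoboundary h) := by
  rw [delta_Tr_eq_zero_iff_cyc] at hf
  set F := cyc f with hF
  set α : ℕ → k := fun d => F (List.replicate d 0 ++ [1]) with hα
  have h1 : ∀ v : List (Fin 2), F (v ++ [1]) =
      α v.length * (1 - if ∀ j ∈ v, j = 1 then 1 else 0) := by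
    intro v
    -- On the test word vz, merging x with y gives x^d y and merging y with z gives vy, where d is
    -- the length of v. Hence F(vy) is α(d), or 0 when v contains only y.
    have h := hf (v.map ![0, 1] ++ [2])
    have e1 : (v.map ![(0 : Fin 3), 1] ++ [2]).map ![0, 0, 1] =
        List.replicate v.length (0 : Fin 2) ++ [1] := by
      rw [List.map_append, List.map_map, List.map_singleton]
      congr 1
      rw [← List.map_const']
      refine List.map_congr_left fun j _ => ?_
      fin_cases j <;> rfl
    have e2 : (v.map ![(0 : Fin 3), 1] ++ [2]).map ![0, 1, 1] = v ++ [(1 : Fin 2)] := by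
      rw [List.map_append, List.map_map, List.map_singleton]
      congr 1
      conv_rhs => rw [← List.map_id v]
      refine List.map_congr_left fun j _ => ?_
      fin_cases j <;> rfl
    have e3 : (∀ j ∈ v.map ![(0 : Fin 3), 1] ++ [2], j ≠ 0) ↔ ∀ j ∈ v, j = 1 := by
      have : ∀ j : Fin 2, (![(0 : Fin 3), 1] j ≠ 0) ↔ j = 1 := by decide
      simp only [List.forall_mem_append, List.forall_mem_map, this, List.forall_mem_singleton]
      exact and_iff_left (by decide)
    have e4 : ¬ ∀ j ∈ v.map ![(0 : Fin 3), 1] ++ [2], j ≠ 2 := fun h =>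
      h 2 (by simp) rfl
    rw [e1, e2, if_neg e4, sub_zero] at h
    simp only [e3] at h
    change (if ∀ j ∈ v, j = 1 then α v.length else 0) - α v.length + F (v ++ [1]) = 0 at h
    split_ifs at h ⊢ <;> linear_combination h
  have h2 : ∀ d, F (List.replicate (d + 1) 0) = 0 := by
    intro d
    have h := hf (List.replicate (d + 1) 0)
    rw [if_neg (fun h => h 0 (by simp) rfl), if_pos (fun j hj => by
      rw [List.eq_of_mem_replicate hj]; decide)] at h
    simpa using h
  have h3 : ∀ w : List (Fin 2), w ≠ [] → F w = α (w.length - 1) *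
      (1 - (if ∀ j ∈ w, j = 1 then 1 else 0) - (if ∀ j ∈ w, j = 0 then 1 else 0)) := by
    intro w hw
    -- A word containing y can be rotated so as to end in y; the remaining words are powers of x.
    by_cases hm : (1 : Fin 2) ∈ w
    · obtain ⟨a, b, rfl⟩ := List.append_of_mem hm
      have e : (a ++ 1 :: b).rotate (a ++ [1]).length = (b ++ a) ++ [1] := by
        rw [show a ++ 1 :: b = (a ++ [1]) ++ b by simp, List.rotate_append_length_eq]
        simp
      rw [hF, ← cyc_rotate f _ (a ++ [1]).length, e, ← hF, h1]
      have e0 : ¬ ∀ j ∈ a ++ 1 :: b, j = 0 := fun h => by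
        have := h 1 hm
        exact absurd this (by decide)
      have e1 : (∀ j ∈ b ++ a, j = 1) ↔ ∀ j ∈ a ++ 1 :: b, j = 1 := by
        simp only [List.forall_mem_append, List.forall_mem_cons, true_and]
        exact and_comm
      have e2 : (b ++ a).length = (a ++ 1 :: b).length - 1 := by simp; omega
      simp only [e0, e1, e2, if_false, sub_zero]
    · have h0 : ∀ j ∈ w, j = 0 := fun j hj => by
        have : j ≠ 1 := fun h => hm (h ▸ hj)
        omega
      have e : w = List.replicate (w.length - 1 + 1) 0 := by
        rw [Nat.sub_add_cancel (List.length_pos_iff.2 hw)]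
        exact List.eq_replicate_of_mem h0
      have e1 : ¬ ∀ j ∈ w, j = 1 := fun h => by
        obtain ⟨j, hj⟩ := List.exists_mem_of_ne_nil w hw
        exact hm (h j hj ▸ hj)
      rw [if_neg e1, if_pos h0, sub_zero, sub_self, mul_zero, e]
      exact h2 _
  -- The inverse length compensates the factor d in `cyc_addCoboundary`, and the sign reverses its
  -- bracket of indicators.
  refine ⟨⟨fun v => -((v.length : k)⁻¹ * α (v.length - 1))⟩, ?_⟩
  rw [Tr_eq_Tr, mem_trKer_iff, map_sub, sub_eq_zero]
  ext w
  rw [cyc_addCoboundary]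
  by_cases hw : w = []
  · subst hw; simp [cyc_apply]
  · have h0 : (w.length : k) ≠ 0 := Nat.cast_ne_zero.2 (by simpa using hw)
    change F w = _
    rw [h3 w hw]
    simp only [List.length_replicate]
    field_simp
    ring

end Cocycles

/-! ### Identities between e^x and (e^x - 1)/x -/

section Inverses

variable {k : Type*} [Field k] [CharZero k]

variable (k) in
theorem evalNeg_expS_mul : PowerSeries.evalNegHom (expS k) * expS k = 1 := by
  have h : expS k = PowerSeries.exp k := by
    ext n
    simp [expS, PowerSeries.coeff_exp]
  rw [h, mul_comm]
  exact PowerSeries.exp_mul_exp_neg_eq_one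

-- With φ(x) = (e^x - 1)/x this is φ(-x) = e^{-x} φ(x), checked after multiplication by x. It
-- computes j of an inverse.
variable (k) in
theorem evalNeg_phiS : PowerSeries.evalNegHom (phiS k) =
    PowerSeries.evalNegHom (expS k) * phiS k := by
  have h0 : (PowerSeries.X : PowerSeries k) ≠ 0 := PowerSeries.X_ne_zero
  refine mul_left_cancel₀ h0 ?_
  have h1 := congrArg (PowerSeries.evalNegHom (A := k)) (X_mul_phiS k)
  rw [map_add, map_mul, map_one, PowerSeries.evalNegHom_X] at h1
  linear_combination -h1 - evalNeg_expS_mul k - PowerSeries.evalNegHom (expS k) * X_mul_phiS k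

end Inverses

/-! ### Exponentials as automorphisms and their effect on traces -/

namespace TDer

variable {k : Type*} [Field k] [CharZero k] {n : ℕ}

theorem ser_mem_trKer (c : PowerSeries k) (u : TDer k n) {f : Ass k n} (hf : f ∈ trKer k n) :
    ser c u.toEnd f ∈ trKer k n := by
  refine lsum_mem_trKer fun r => Submodule.smul_mem _ _ ?_
  induction r with
  | zero => exact hf
  | succ r ih => rw [pow_succ', Module.End.mul_apply]; exact u.toEnd_mem_trKer ih

theorem Tr_ser_congr (c : PowerSeries k) (u : TDer k n) {f g : Ass k n} (h : Tr f = Tr g) :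
    Tr (ser c u.toEnd f) = Tr (ser c u.toEnd g) := by
  rw [Tr_eq_Tr, ← map_sub]
  exact u.ser_mem_trKer c (Tr_eq_Tr.1 h)

omit [CharZero k] in
theorem ser_apply_eq (c : PowerSeries k) (u : TDer k n) (f : Ass k n) : ser c u.toEnd f =
    PowerSeries.coeff 0 c • f +
      lsum fun r => PowerSeries.coeff (r + 1) c • (u.toEnd ^ r) (u.toEnd f) := by
  have h : ∀ r, (PowerSeries.coeff r c • u.toEnd ^ r) f ∈ fil r := fun r =>
    End.apply_mem (ser_term_mem c u.toEnd_mem_fil r) f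
  have h1 : ∀ r, (if r = 0 then 0 else (PowerSeries.coeff r c • u.toEnd ^ r) f) ∈ fil r :=
    fun r => by
      split_ifs
      · exact zero_mem _
      · exact h r
  have h2 : ∀ r, (if r = 0 then PowerSeries.coeff 0 c • f else 0) ∈ fil r := fun r => by
    split_ifs with hr
    · subst hr; exact Ass.mem_fil_zero _
    · exact zero_mem _
  have h3 : ser c u.toEnd f = lsum fun r => (if r = 0 then PowerSeries.coeff 0 c • f else 0) +
      (if r = 0 then 0 else (PowerSeries.coeff r c • u.toEnd ^ r) f) := by
    rw [ser, End.lsum_apply]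
    congr 1
    funext r
    cases r <;> simp
  rw [h3, lsum_add h2 h1, lsum_single (m := 0) h2 (fun r hr => if_neg hr), if_pos rfl,
    lsum_shift h1 (if_pos rfl)]
  congr 2

omit [CharZero k] in
theorem ser_apply_of_eq_zero (c : PowerSeries k) (u : TDer k n) {f : Ass k n}
    (hf : u.toEnd f = 0) : ser c u.toEnd f = PowerSeries.coeff 0 c • f := by
  rw [ser_apply_eq, hf]
  simp only [map_zero, smul_zero]
  rw [lsum_single (m := 0) (fun _ => zero_mem _) (fun _ _ => rfl), add_zero]

/-- Once u f vanishes in the trace quotient, so do all higher u^r f, and only the constant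
coefficient of the series acts. -/
theorem Tr_ser_of_mem (c : PowerSeries k) (u : TDer k n) {f : Ass k n}
    (hf : u.toEnd f ∈ trKer k n) : Tr (ser c u.toEnd f) = PowerSeries.coeff 0 c • Tr f := by
  rw [← map_smul, Tr_eq_Tr, ser_apply_eq, add_sub_cancel_left]
  refine lsum_mem_trKer fun r => Submodule.smul_mem _ _ ?_
  induction r with
  | zero => exact hf
  | succ r ih => rw [pow_succ', Module.End.mul_apply]; exact u.toEnd_mem_trKer ih

omit [CharZero k] in
theorem exp_mem_fil (u : TDer k n) : u.exp ∈ fil 0 := by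
  rw [exp_eq_ser]
  exact lsum_mem_zero (ser_term_mem _ u.toEnd_mem_fil)

omit [CharZero k] in
theorem exp_one (u : TDer k n) : u.exp 1 = 1 := by
  rw [exp_eq_ser, ser_apply_of_eq_zero _ _ u.toEnd_one]
  simp [expS]

/-- The exponential of a derivation is multiplicative. -/
theorem exp_mul (u : TDer k n) (f g : Ass k n) : u.exp (f * g) = u.exp f * u.exp g := by
  have h : ∀ f r, ((r.factorial : k)⁻¹ • u.toEnd ^ r) f ∈ fil r := fun f r =>
    End.apply_mem (FiltrationSMul.smul_mem _ (pow_mem_fil u.toEnd_mem_fil r)) f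
  -- For a derivation, the commutator with left multiplication by f is left multiplication by u f.
  -- The higher Leibniz rule is thus an instance of `divPow_mul`.
  have h1 : ∀ i, iterBracket u.toEnd (LinearMap.mulLeft k f) i =
      LinearMap.mulLeft k ((u.toEnd ^ i) f) := fun i => by
    induction i with
    | zero => rfl
    | succ i ih =>
      refine LinearMap.ext fun x => ?_
      rw [iterBracket_succ, ih, pow_succ']
      simp [u.leibniz]
  have h2 : ∀ r, ((r.factorial : k)⁻¹ • u.toEnd ^ r) (f * g) =
      ∑ p ∈ Finset.HasAntidiagonal.antidiagonal r,
        ((p.1.factorial : k)⁻¹ • u.toEnd ^ p.1) f * ((p.2.factorial : k)⁻¹ • u.toEnd ^ p.2) g :=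
    fun r => by
      have := LinearMap.congr_fun
        (divPow_mul (k := k) u.toEnd (LinearMap.mulLeft k f) r) g
      rw [LinearMap.sum_apply] at this
      simpa [h1] using this
  simp only [exp_eq_ser, ser, expS, PowerSeries.coeff_mk, End.lsum_apply]
  rw [lsum_mul_lsum (h f) (h g)]
  simp only [h2]

omit [CharZero k] in
theorem neg_toEnd (u : TDer k n) : ((-1 : k) • u).toEnd = -u.toEnd := by
  rw [smul_toEnd, neg_one_smul]

theorem exp_neg_mul_exp (u : TDer k n) : ((-1 : k) • u).exp * u.exp = 1 := by
  rw [exp_eq_ser, exp_eq_ser, neg_toEnd, ser_evalNeg, ← ser_mul _ _ u.toEnd_mem_fil,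
    evalNeg_expS_mul, ser_one u.toEnd_mem_fil]

theorem exp_mul_exp_neg (u : TDer k n) : u.exp * ((-1 : k) • u).exp = 1 := by
  rw [exp_eq_ser, exp_eq_ser, neg_toEnd, ser_evalNeg, ← ser_mul _ _ u.toEnd_mem_fil,
    mul_comm, evalNeg_expS_mul, ser_one u.toEnd_mem_fil]

/-- φ(-u)(-div u) = -e^{-u} φ(u)(div u), by `evalNeg_phiS`. -/
theorem j_neg (u : TDer k n) : ((-1 : k) • u).j = -Tr (((-1 : k) • u).exp u.jRep) := by
  rw [j_eq, jRep, jRep, exp_eq_ser, neg_toEnd, ser_evalNeg, ser_evalNeg, evalNeg_phiS,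
    ser_mul _ _ u.toEnd_mem_fil, divRep_smul, neg_one_smul, map_neg, map_neg,
    Module.End.mul_apply]

/-- The exponential as a unit of the ring of endomorphisms. -/
def expUnit (u : TDer k n) : (Module.End k (Ass k n))ˣ :=
  ⟨u.exp, ((-1 : k) • u).exp, u.exp_mul_exp_neg, u.exp_neg_mul_exp⟩

theorem ser_phiS_inv (u : TDer k n) (f : Ass k n) :
    ser (phiS k)⁻¹ u.toEnd (ser (phiS k) u.toEnd f) = f := by
  have h : PowerSeries.constantCoeff (phiS k) ≠ 0 := by
    rw [← PowerSeries.coeff_zero_eq_constantCoeff_apply]; simp [phiS]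
  rw [← Module.End.mul_apply, ← ser_mul _ _ u.toEnd_mem_fil, PowerSeries.inv_mul_cancel _ h,
    ser_one u.toEnd_mem_fil, Module.End.one_apply]

/-- exp(u) f - f is φ(u) applied to u f, and φ(u) is injective because φ has constant coefficient 1.
-/
theorem toEnd_eq_zero_of_exp_eq {u : TDer k n} {f : Ass k n} (h : u.exp f = f) :
    u.toEnd f = 0 := by
  rw [exp_eq_ser, ← X_mul_phiS, mul_comm, ser_add _ _ u.toEnd_mem_fil,
    ser_mul _ _ u.toEnd_mem_fil, ser_X u.toEnd_mem_fil, ser_one u.toEnd_mem_fil,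
    LinearMap.add_apply, Module.End.one_apply, Module.End.mul_apply, add_eq_right] at h
  rw [← u.ser_phiS_inv (u.toEnd f), h, map_zero]

omit [CharZero k] in
theorem exp_eq_of_toEnd_eq_zero {u : TDer k n} {f : Ass k n} (h : u.toEnd f = 0) :
    u.exp f = f := by
  rw [exp_eq_ser, ser_apply_of_eq_zero _ _ h]
  simp [expS]

-- On series in x_i alone u agrees with the inner derivation f ↦ f a_i - a_i f: the difference is a
-- derivation preserving the order and killing x_i. Hence the image is a commutator.
omit [CharZero k] in
theorem toEnd_subst_X_mem (u : TDer k n) (i : Fin n) (h : Ass k 1) :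
    u.toEnd (subst ![X i] (by simp [X_nil]) h) ∈ trKer k n := by
  set D : Module.End k (Ass k n) :=
    u.toEnd - (LinearMap.mulRight k (u.comp i) - LinearMap.mulLeft k (u.comp i)) with hD
  have hDa : ∀ f, D f = u.toEnd f - (f * u.comp i - u.comp i * f) := fun f => by simp [hD]
  have h0 : D (subst ![X i] (by simp [X_nil]) h) = 0 := by
    refine derivation_subst D (fun f g => ?_) (fun p f hf => ?_) _ (fun l => ?_) h
    · simp only [hDa, u.leibniz]; noncomm_ring
    · rw [hDa]
      have h1 := CompleteFiltration.mul_mem hf (Ass.mem_fil_zero (u.comp i))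
      have h2 := CompleteFiltration.mul_mem (Ass.mem_fil_zero (u.comp i)) hf
      rw [zero_add] at h2
      exact sub_mem (fil_le (Nat.le_succ p) (u.toEnd_mem_fil p f hf)) (sub_mem h1 h2)
    · have : (![X i] : Fin 1 → Ass k n) l = X i := by fin_cases l; rfl
      rw [this, hDa, u.map_X, sub_self]
  rw [hDa, sub_eq_zero] at h0
  rw [h0]
  exact Submodule.subset_span (Or.inr ⟨_, _, rfl⟩)

omit [CharZero k] in
theorem toEnd_addCoboundary_mem {u : TDer k 2} (hu : u ∈ sder2 k) (h : Ass k 1) :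
    u.toEnd (addCoboundary h) ∈ trKer k 2 := by
  have h1 : u.toEnd (subst ![X 0 + X 1] (by simp [X_nil]) h) = 0 :=
    derivation_subst u.toEnd u.leibniz (fil_le zero_le_one u.toEnd_mem_fil) _
      (fun l => by fin_cases l; exact hu) h
  rw [addCoboundary, map_add, map_sub, h1, sub_zero]
  exact add_mem (u.toEnd_subst_X_mem 1 h) (u.toEnd_subst_X_mem 0 h)

/-- The automorphism carries h(x + y) to h(ch(x, y)), while h(x) and h(y) change only by
commutators. This links HKV_2 with the condition on solutions. -/
theorem Tr_exp_addCoboundary {u : TDer k 2} (hu : u.exp (X 0 + X 1) = ch k) (h : Ass k 1) :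
    Tr (u.exp (addCoboundary h)) = deltaTilde k (Tr h) := by
  have h1 : u.exp (subst ![X 0 + X 1] (by simp [X_nil]) h) =
      subst ![ch k] (by simp [ch_nil]) h :=
    map_subst u.exp u.exp_one u.exp_mul (fun N f hf => u.exp_mem_fil N f hf) _ _
      (fun l => by fin_cases l; exact hu) h
  have h2 : ∀ i, Tr (u.exp (subst ![X i] (by simp [X_nil]) h)) =
      Tr (subst ![X i] (by simp [X_nil]) h) := fun i => by
    rw [exp_eq_ser, u.Tr_ser_of_mem _ (u.toEnd_subst_X_mem i h)]
    simp [expS]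
  rw [addCoboundary, map_add, map_sub, h1, map_add, map_sub, h2, h2]
  rfl

theorem Tr_ser_addCoboundary (c : PowerSeries k) {u : TDer k 2} (hu : u ∈ sder2 k)
    {f : Ass k 2} {h : Ass k 1} (hf : Tr f = Tr (addCoboundary h)) :
    Tr (ser c u.toEnd f) = PowerSeries.coeff 0 c • Tr (addCoboundary h) := by
  rw [u.Tr_ser_congr c hf, u.Tr_ser_of_mem c (toEnd_addCoboundary_mem hu h)]

end TDer

/-! ### The group HKV_2 and its action on the solutions -/

section Main

variable {k : Type*} [Field k] [CharZero k]

/-- Replaces the condition on div by one on j, to which the cocycle identity applies. A special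
derivation kills `addCoboundary h` in tr_2, so φ(u) and φ(u)⁻¹ both act on its class by their
constant coefficient 1. -/
theorem mem_HKV2_iff {G : Module.End k (Ass k 2)} : G ∈ HKV2 k ↔
    ∃ u : TDer k 2, u.exp = G ∧ u ∈ sder2 k ∧ ∃ h, u.j = Tr (addCoboundary h) := by
  have h0 : PowerSeries.coeff 0 (phiS k) = 1 := by simp [phiS]
  have h1 : PowerSeries.coeff 0 (phiS k)⁻¹ = 1 := by
    rw [PowerSeries.coeff_zero_eq_constantCoeff_apply, PowerSeries.constantCoeff_inv,
      ← PowerSeries.coeff_zero_eq_constantCoeff_apply, h0, inv_one]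
  constructor
  · rintro ⟨u, ⟨hu, hd⟩, rfl⟩
    obtain ⟨h, hh⟩ := exists_Tr_eq_of_delta_eq_zero (LinearMap.mem_ker.1 hd)
    refine ⟨u, rfl, hu, h, ?_⟩
    rw [u.j_eq, TDer.jRep, TDer.Tr_ser_addCoboundary _ hu hh, h0, one_smul]
  · rintro ⟨u, rfl, hu, h, hh⟩
    refine ⟨u, ⟨hu, ?_⟩, rfl⟩
    have : u.div = Tr (addCoboundary h) := by
      rw [u.j_eq] at hh
      rw [TDer.div, ← u.ser_phiS_inv u.divRep]
      change Tr (ser (phiS k)⁻¹ u.toEnd u.jRep) = _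
      rw [TDer.Tr_ser_addCoboundary _ hu hh, h1, one_smul]
    rw [LinearMap.mem_ker, this]
    exact delta_addCoboundary h

theorem exp_mem_HKV2 {u : TDer k 2} (hu : u.exp (X 0 + X 1) = X 0 + X 1) {h : Ass k 1}
    (hj : u.j = Tr (addCoboundary h)) : u.exp ∈ HKV2 k :=
  mem_HKV2_iff.2 ⟨u, rfl, TDer.toEnd_eq_zero_of_exp_eq hu, h, hj⟩

theorem Tr_exp_of_mem_sder2 {u : TDer k 2} (hu : u ∈ sder2 k) {f : Ass k 2} {h : Ass k 1}
    (hf : Tr f = Tr (addCoboundary h)) : Tr (u.exp f) = Tr (addCoboundary h) := by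
  rw [TDer.exp_eq_ser, TDer.Tr_ser_addCoboundary _ hu hf]
  simp [expS]

theorem mul_mem_HKV2 {F G : Module.End k (Ass k 2)} (hF : F ∈ HKV2 k) (hG : G ∈ HKV2 k) :
    F * G ∈ HKV2 k := by
  obtain ⟨u, rfl, hu, g, hg⟩ := mem_HKV2_iff.1 hF
  obtain ⟨v, rfl, hv, h, hh⟩ := mem_HKV2_iff.1 hG
  obtain ⟨w, hw, hj⟩ := TDer.exists_exp_eq_mul u v
  rw [← hw]
  refine exp_mem_HKV2 (h := g + h) ?_ ?_
  · rw [hw, Module.End.mul_apply, TDer.exp_eq_of_toEnd_eq_zero hv,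
      TDer.exp_eq_of_toEnd_eq_zero hu]
  · rw [hj, hg, Tr_exp_of_mem_sder2 hu (v.j_eq ▸ hh), addCoboundary_add, map_add]

theorem neg_exp_mem_HKV2 {u : TDer k 2} (hu : u ∈ sder2 k) {h : Ass k 1}
    (hh : u.j = Tr (addCoboundary h)) : ((-1 : k) • u).exp ∈ HKV2 k := by
  have hn : (-1 : k) • u ∈ sder2 k := by
    change ((-1 : k) • u).toEnd _ = 0
    rw [TDer.neg_toEnd, LinearMap.neg_apply, show u.toEnd (X 0 + X 1) = 0 from hu, neg_zero]
  refine mem_HKV2_iff.2 ⟨_, rfl, hn, -h, ?_⟩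
  rw [u.j_neg, Tr_exp_of_mem_sder2 hn (u.j_eq ▸ hh), addCoboundary_neg, map_neg]

variable (k) in
/-- `HKV_2` as a group of automorphisms. -/
def HKV2Subgroup : Subgroup (Module.End k (Ass k 2))ˣ where
  carrier := {g | (g : Module.End k (Ass k 2)) ∈ HKV2 k}
  mul_mem' hg hh := mul_mem_HKV2 hg hh
  one_mem' := by
    refine mem_HKV2_iff.2 ⟨0, ?_, rfl, 0, ?_⟩
    · exact LinearMap.ext fun f => TDer.exp_eq_of_toEnd_eq_zero rfl
    · have h1 : (0 : TDer k 2).divRep = 0 := by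
        simp only [TDer.divRep_eq, TDer.zero_comp, map_zero, Finset.sum_const_zero]
      rw [TDer.j_eq, TDer.jRep, h1]
      simp [addCoboundary]
  inv_mem' {g} hg := by
    obtain ⟨u, hu, hs, h, hh⟩ := mem_HKV2_iff.1 hg
    have : g = u.expUnit := Units.ext hu.symm
    rw [this]
    exact neg_exp_mem_HKV2 hs hh

theorem coe_image_HKV2Subgroup :
    Units.val '' (HKV2Subgroup k : Set (Module.End k (Ass k 2))ˣ) = HKV2 k := by
  ext G
  constructor
  · rintro ⟨g, hg, rfl⟩
    exact hg
  · intro hG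
    obtain ⟨u, rfl, -⟩ := mem_HKV2_iff.1 hG
    exact ⟨u.expUnit, hG, rfl⟩

/-- j(FG) = j(F) + F·j(G), and F turns the additive coboundary j(G) into a value of δ̃. -/
theorem mul_mem_SolHKV {F G : Module.End k (Ass k 2)} (hF : F ∈ SolHKV k) (hG : G ∈ HKV2 k) :
    F * G ∈ SolHKV k := by
  obtain ⟨u, rfl, hu, f, hf⟩ := hF
  obtain ⟨v, rfl, hv, h, hh⟩ := mem_HKV2_iff.1 hG
  obtain ⟨w, hw, hj⟩ := TDer.exists_exp_eq_mul u v
  rw [v.j_eq] at hh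
  refine ⟨w, hw.symm, ?_, f + Tr h, ?_⟩
  · rw [Module.End.mul_apply, TDer.exp_eq_of_toEnd_eq_zero hv, hu]
  · rw [hj, map_add, hf, ← TDer.Tr_exp_addCoboundary hu, TDer.exp_eq_ser,
      ← u.Tr_ser_congr _ hh]

/-- The element is F⁻¹G. Its j is F⁻¹·(j(G) - j(F)), and F⁻¹ turns the value of δ̃ in the bracket
back into an additive coboundary. -/
theorem exists_mem_HKV2_mul_eq {F G : Module.End k (Ass k 2)} (hF : F ∈ SolHKV k)
    (hG : G ∈ SolHKV k) : ∃ g ∈ HKV2 k, F * g = G := by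
  obtain ⟨u, rfl, hu, f, hf⟩ := hF
  obtain ⟨v, rfl, hv, g, hg⟩ := hG
  obtain ⟨f, rfl⟩ := Tr_surjective f
  obtain ⟨g, rfl⟩ := Tr_surjective g
  obtain ⟨w, hw, hj⟩ := TDer.exists_exp_eq_mul ((-1 : k) • u) v
  have hinv : ∀ x, ((-1 : k) • u).exp (u.exp x) = x := fun x =>
    LinearMap.congr_fun u.exp_neg_mul_exp x
  refine ⟨w.exp, exp_mem_HKV2 (h := g - f) ?_ ?_, ?_⟩
  · rw [hw, Module.End.mul_apply, hv, ← hu, hinv]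
  · have h1 : Tr (v.jRep - u.jRep) = Tr (u.exp (addCoboundary (g - f))) := by
      rw [TDer.Tr_exp_addCoboundary hu, map_sub, map_sub, map_sub, hf, hg, TDer.j_eq, TDer.j_eq]
    have h2 := TDer.Tr_ser_congr (expS k) ((-1 : k) • u) h1
    rw [← TDer.exp_eq_ser, hinv, map_sub, map_sub] at h2
    rw [hj, u.j_neg, ← h2]
    abel
  · rw [hw, ← mul_assoc, u.exp_mul_exp_neg, one_mul]

theorem isUnit_of_mem_SolHKV {F : Module.End k (Ass k 2)} (hF : F ∈ SolHKV k) : IsUnit F := by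
  obtain ⟨u, rfl, -⟩ := hF
  exact ⟨u.expUnit, rfl⟩

end Main

end KashiwaraVergne

end

theorem mainTheorem3 (k : Type*) [Field k] [CharZero k]
    (hne : (KashiwaraVergne.SolHKV k).Nonempty) :
    ∃ H : Subgroup (Module.End k (KashiwaraVergne.Ass k 2))ˣ,
      Units.val '' (H : Set (Module.End k (KashiwaraVergne.Ass k 2))ˣ) = KashiwaraVergne.HKV2 k ∧
      ∃ _act : MulAction (↥H)ᵐᵒᵖ (KashiwaraVergne.SolHKV k),
        (∀ (g : H) (F : KashiwaraVergne.SolHKV k),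
          ((MulOpposite.op g • F : KashiwaraVergne.SolHKV k) :
              Module.End k (KashiwaraVergne.Ass k 2)) =
            (F : Module.End k (KashiwaraVergne.Ass k 2)) *
              ((g : (Module.End k (KashiwaraVergne.Ass k 2))ˣ) :
                Module.End k (KashiwaraVergne.Ass k 2))) ∧
        (∀ (g : H) (F : KashiwaraVergne.SolHKV k), MulOpposite.op g • F = F → g = 1) ∧
        (∀ F₁ F₂ : KashiwaraVergne.SolHKV k, ∃ g : H, MulOpposite.op g • F₁ = F₂) := by
  refine ⟨KashiwaraVergne.HKV2Subgroup k, KashiwaraVergne.coe_image_HKV2Subgroup,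
    { smul := fun g F => ⟨F.1 * (g.unop.1 : Module.End k (KashiwaraVergne.Ass k 2)),
        KashiwaraVergne.mul_mem_SolHKV F.2 g.unop.2⟩
      one_smul := fun F => Subtype.ext (mul_one F.1)
      mul_smul := fun g h F => Subtype.ext (mul_assoc F.1 _ _).symm }, fun g F => rfl, ?_, ?_⟩
  · intro g F h
    have h1 : F.1 * (g.1 : Module.End k (KashiwaraVergne.Ass k 2)) = F.1 := congrArg Subtype.val h
    -- A solution is an exponential, hence invertible, so Fg = F forces g = 1.
    have h2 :=
      (KashiwaraVergne.isUnit_of_mem_SolHKV F.2).mul_left_cancel (h1.trans (mul_one _).symm)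
    exact Subtype.ext (Units.ext h2)
  · intro F₁ F₂
    obtain ⟨g, hg, h⟩ := KashiwaraVergne.exists_mem_HKV2_mul_eq F₁.2 F₂.2
    rw [← KashiwaraVergne.coe_image_HKV2Subgroup] at hg
    obtain ⟨g, hg, rfl⟩ := hg
    exact ⟨⟨g, hg⟩, Subtype.ext h⟩
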